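/- Conventions. Let $\mathbb K\in\{\mathbb R,\mathbb C\}$. A Lie group is a group which is a smooth manifold modeled on a (Hausdorff) locally convex $\mathbb K$-space, with smooth multiplication and inversion; a map between open subsets of locally convex spaces is $C^1$ if it is continuous, all directional derivatives $df(x)(h)$ exist and $df$ is continuous, it is $C^{n+1}$ if it is $C^1$ and $df$ is $C^{n}$, and it is smooth if it is $C^n$ for all $n$. Let $G$, $N$ be Lie groups and $Z(N)$ the center of $N$; $C_N(n)(m)=nmn^{-1}$. $C^1_s(G,N)$ is the set of maps $f:G\to N$ with $f(1)=1$ that are smooth on an identity neighborhood; $C^2_s(G,N)$ is the set of maps $\omega:G\times G\to N$ with $\omega(g,1)=\omega(1,g)=1$ that are smooth on an identity neighborhood; $C^2_{ss}(G,N)$ is the set of those $\omega\in C^2_s(G,N)$ for which, for every $g\in G$, the map $x\mapsto\omega(g,x)\,\omega(gxg^{-1},g)^{-1}$ is smooth on an identity neighborhood. $C^1_s(G,\mathrm{Aut}(N))$ is the set of maps $S:G\to\mathrm{Aut}(N)$ into the Lie group automorphisms of $N$ with $S(1)=\mathrm{id}_N$ such that $(g,n)\mapsto S(g)(n)$ is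 smooth on $U\times N$ for some identity neighborhood $U$. Such an $S$ is a smooth outer action if $S(g)S(g')S(gg')^{-1}=C_N(\omega(g,g'))$ for some $\omega\in C^2_s(G,N)$; $S\sim S'$ means $S'(g)=C_N(h(g))S(g)$ for some $h\in C^1_s(G,N)$, and the classes $[S]$ are the smooth $G$-kernels. For $\beta:G\times G\to Z(N)$ and $\alpha:G\to Z(N)$ put $(d_S\beta)(g,g',g'')=S(g)(\beta(g',g''))\,\beta(g,g'g'')\,\beta(gg',g'')^{-1}\beta(g,g')^{-1}$ and $(d_S\alpha)(g,g')=S(g)(\alpha(g'))\,\alpha(gg')^{-1}\alpha(g)$. Let $Z^2_{ss}(G,Z(N))_{[S]}$ be the group of $Z(N)$-valued $\beta\in C^2_{ss}(G,N)$ with $d_S\beta=1$, $B^2_s(G,Z(N))_{[S]}$ the group of all $d_S\alpha$ with $\alpha\in C^1_s(G,N)$ $Z(N)$-valued, and $H^2_{ss}(G,Z(N))_{[S]}=Z^2_{ss}(G,Z(N))_{[S]}/B^2_s(G,Z(N))_{[S]}$; these depend only on $[S]$. An extension of $G$ by $N$ is a short exact sequence $1\to N\xrightarrow{\iota}\widehat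 G\xrightarrow{q}G\to1$ of Lie group morphisms for which $\widehat G$ is a smooth principal $N$-bundle over $G$; two extensions are equivalent if there is a Lie group morphism between the total groups inducing the identity on $N$ and on $G$; $\mathrm{Ext}(G,N)$ is the set of equivalence classes. An extension corresponds to $[S]$ if, for a section $\sigma$ of $q$ with $\sigma(1)=1$, smooth on an identity neighborhood, the map $S'$ defined by $\iota(S'(g)(n))=\sigma(g)\iota(n)\sigma(g)^{-1}$ satisfies $S'\sim S$; $\mathrm{Ext}(G,N)_{[S]}$ is the set of classes of such extensions. A smooth factor system is a pair $(S,\omega)$ with $S\in C^1_s(G,\mathrm{Aut}(N))$, $\omega\in C^2_{ss}(G,N)$, $S(g)S(g')S(gg')^{-1}=C_N(\omega(g,g'))$ and $S(g)(\omega(g',g''))\,\omega(g,g'g'')=\omega(g,g')\,\omega(gg',g'')$. Then $N\times_{(S,\omega)}G$ is the set $N\times G$ with the multiplication $(n,g)(n',g')=(n\,S(g)(n')\,\omega(g,g'),gg')$, with a Lie group structure making $N\to N\times_{(S,\omega)}G\to G$ an extension of Lie groups and for which $N\times G\to N\times_{(S,\omega)}G$, $(n,g)\mapsto(n,g)$,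 is smooth on $N\times U$ for some open identity neighborhood $U\subseteq G$. Statement. Let $S$ be a smooth outer action of $G$ on $N$ with $\mathrm{Ext}(G,N)_{[S]}\neq\emptyset$. Then: (0) For every smooth factor system $(S',\omega)$ with $S'\sim S$, the extension $N\times_{(S',\omega)}G$ exists and defines exactly one class $[N\times_{(S',\omega)}G]$, which belongs to $\mathrm{Ext}(G,N)_{[S]}$. (1) Every class in $\mathrm{Ext}(G,N)_{[S]}$ is of the form $[N\times_{(S,\omega)}G]$ for a smooth factor system $(S,\omega)$. If $(S,\omega)$ and $(S,\omega')$ are smooth factor systems, then $\omega'\omega^{-1}\in Z^2_{ss}(G,Z(N))_{[S]}$, and $N\times_{(S,\omega)}G$ and $N\times_{(S,\omega')}G$ are equivalent extensions if and only if $\omega'\omega^{-1}\in B^2_s(G,Z(N))_{[S]}$. (2) The assignment $$[\beta]\cdot[N\times_{(S',\omega)}G]=[N\times_{(S',\omega\cdot\beta)}G]$$ (for smooth factor systems $(S',\omega)$ with $S'\sim S$ and $\beta\in Z^2_{ss}(G,Z(N))_{[S]}$) is a well-defined simply transitive action of the group $H^2_{ss}(G,Z(N))_{[S]}$ on $\mathrm{Ext}(G,N)_{[S]}$.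 -/

import Mathlib

open Filter Topology Set

universe w u v

namespace NonabelianExt

section Calculus

variable {𝕜 : Type*} [RCLike 𝕜]

/-- `y` is the derivative of `f` at `x` in the direction `h`. -/
def HasDirDeriv (𝕜 : Type*) [RCLike 𝕜] {X Y : Type*} [AddCommGroup X] [Module 𝕜 X]
    [AddCommGroup Y] [Module 𝕜 Y] [TopologicalSpace Y] (f : X → Y) (x h : X) (y : Y) : Prop :=
  Tendsto (fun t : 𝕜 => t⁻¹ • (f (x + t • h) - f x)) (𝓝[≠] 0) (𝓝 y)

/-- `f` is of class `C^n` on the open set `U`: it is continuous on `U` and, for `n + 1`, all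
directional derivatives exist on `U` and `df : U × X → Y` is of class `C^n`. -/
def CnOn (𝕜 : Type*) [RCLike 𝕜] : ∀ (_ : ℕ) {X Y : Type _} [AddCommGroup X] [Module 𝕜 X]
    [TopologicalSpace X] [AddCommGroup Y] [Module 𝕜 Y] [TopologicalSpace Y],
    (X → Y) → Set X → Prop
  | 0, _, _, _, _, _, _, _, _, f, U => ContinuousOn f U
  | n + 1, X, Y, _, _, _, _, _, _, f, U => ContinuousOn f U ∧
      ∃ df : X × X → Y, (∀ x ∈ U, ∀ h, HasDirDeriv 𝕜 f x h (df (x, h))) ∧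
        CnOn 𝕜 n df (U ×ˢ univ)

/-- `f` is smooth on the open set `U`. -/
def SmoothOnOpen (𝕜 : Type*) [RCLike 𝕜] {X Y : Type*} [AddCommGroup X] [Module 𝕜 X]
    [TopologicalSpace X] [AddCommGroup Y] [Module 𝕜 Y] [TopologicalSpace Y]
    (f : X → Y) (U : Set X) : Prop :=
  ∀ n, CnOn 𝕜 n f U

end Calculus

section CalculusLemmas

variable {𝕜 : Type*} [RCLike 𝕜]

section basic

variable {X Y Z : Type*} [AddCommGroup X] [Module 𝕜 X] [TopologicalSpace X]
  [AddCommGroup Y] [Module 𝕜 Y] [TopologicalSpace Y]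
  [AddCommGroup Z] [Module 𝕜 Z] [TopologicalSpace Z]

theorem CnOn.continuousOn {n : ℕ} {f : X → Y} {U : Set X} (h : CnOn 𝕜 n f U) :
    ContinuousOn f U := by
  cases n with
  | zero => exact h
  | succ n => exact h.1

end basic

theorem CnOn.of_succ {n : ℕ} : ∀ {X : Type*} {Y : Type*} [AddCommGroup X] [Module 𝕜 X]
    [TopologicalSpace X] [AddCommGroup Y] [Module 𝕜 Y] [TopologicalSpace Y]
    {f : X → Y} {U : Set X}, CnOn 𝕜 (n + 1) f U → CnOn 𝕜 n f U := by
  induction n with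
  | zero => intro X Y _ _ _ _ _ _ f U h; exact h.1
  | succ n ih =>
    intro X Y _ _ _ _ _ _ f U h
    obtain ⟨hc, df, h1, h2⟩ := h
    exact ⟨hc, df, h1, ih h2⟩

theorem CnOn.mono {n : ℕ} : ∀ {X : Type*} {Y : Type*} [AddCommGroup X] [Module 𝕜 X]
    [TopologicalSpace X] [AddCommGroup Y] [Module 𝕜 Y] [TopologicalSpace Y]
    {f : X → Y} {U V : Set X}, CnOn 𝕜 n f U → V ⊆ U → CnOn 𝕜 n f V := by
  induction n with
  | zero => intro X Y _ _ _ _ _ _ f U V h hV; exact ContinuousOn.mono h hV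
  | succ n ih =>
    intro X Y _ _ _ _ _ _ f U V h hV
    obtain ⟨hc, df, h1, h2⟩ := h
    exact ⟨hc.mono hV, df, fun x hx => h1 x (hV hx), ih h2 (prod_mono hV subset_rfl)⟩

theorem CnOn.comp_clm {n : ℕ} : ∀ {X : Type*} {Y : Type*} {Z : Type*}
    [AddCommGroup X] [Module 𝕜 X]
    [TopologicalSpace X] [AddCommGroup Y] [Module 𝕜 Y] [TopologicalSpace Y]
    [AddCommGroup Z] [Module 𝕜 Z] [TopologicalSpace Z]
    {f : Y → Z} {U : Set Y} (A : X →L[𝕜] Y), CnOn 𝕜 n f U → CnOn 𝕜 n (f ∘ A) (A ⁻¹' U) := by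
  induction n with
  | zero =>
    intro X Y Z _ _ _ _ _ _ _ _ _ f U A h
    exact ContinuousOn.comp h A.continuous.continuousOn (mapsTo_preimage _ _)
  | succ n ih =>
    intro X Y Z _ _ _ _ _ _ _ _ _ f U A h
    obtain ⟨hc, df, h1, h2⟩ := h
    refine ⟨ContinuousOn.comp hc A.continuous.continuousOn (mapsTo_preimage _ _),
      df ∘ (A.prodMap A), fun x hx h => ?_, ?_⟩
    · have := h1 (A x) hx (A h)
      simpa [HasDirDeriv] using this
    · exact (ih (A.prodMap A) h2).mono (fun p hp => ⟨hp.1, trivial⟩)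

theorem cnOn_clm {n : ℕ} : ∀ {X : Type*} {Y : Type*} [AddCommGroup X] [Module 𝕜 X]
    [TopologicalSpace X] [AddCommGroup Y] [Module 𝕜 Y] [TopologicalSpace Y]
    (A : X →L[𝕜] Y) (U : Set X), CnOn 𝕜 n A U := by
  induction n with
  | zero => intro X Y _ _ _ _ _ _ A U; exact A.continuous.continuousOn
  | succ n ih =>
    intro X Y _ _ _ _ _ _ A U
    refine ⟨A.continuous.continuousOn, A ∘L ContinuousLinearMap.snd 𝕜 X X, fun x _ h => ?_,
      ih _ _⟩
    refine tendsto_nhds_of_eventually_eq ?_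
    filter_upwards [self_mem_nhdsWithin] with t ht
    have ht : t ≠ 0 := ht
    simp [smul_smul, ht]

theorem cnOn_const {n : ℕ} : ∀ {X : Type*} {Y : Type*} [AddCommGroup X] [Module 𝕜 X]
    [TopologicalSpace X] [AddCommGroup Y] [Module 𝕜 Y] [TopologicalSpace Y]
    (c : Y) (U : Set X), CnOn 𝕜 n (fun _ : X => c) U := by
  induction n with
  | zero => intro X Y _ _ _ _ _ _ c U; exact continuousOn_const
  | succ n ih =>
    intro X Y _ _ _ _ _ _ c U
    refine ⟨continuousOn_const, fun _ => 0, fun x _ h => ?_, ih _ _⟩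
    simp [HasDirDeriv, tendsto_const_nhds]

theorem CnOn.prodMk {n : ℕ} : ∀ {X : Type*} {Y : Type*} {Z : Type*}
    [AddCommGroup X] [Module 𝕜 X]
    [TopologicalSpace X] [AddCommGroup Y] [Module 𝕜 Y] [TopologicalSpace Y]
    [AddCommGroup Z] [Module 𝕜 Z] [TopologicalSpace Z]
    {f : X → Y} {g : X → Z} {U : Set X}, CnOn 𝕜 n f U → CnOn 𝕜 n g U →
    CnOn 𝕜 n (fun x => (f x, g x)) U := by
  induction n with
  | zero =>
    intro X Y Z _ _ _ _ _ _ _ _ _ f g U hf hg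
    exact ContinuousOn.prodMk hf hg
  | succ n ih =>
    intro X Y Z _ _ _ _ _ _ _ _ _ f g U hf hg
    obtain ⟨hfc, df, f1, f2⟩ := hf
    obtain ⟨hgc, dg, g1, g2⟩ := hg
    refine ⟨hfc.prodMk hgc, fun p => (df p, dg p), fun x hx h => ?_, ih f2 g2⟩
    exact (f1 x hx h).prodMk_nhds (g1 x hx h)

theorem CnOn.congr {n : ℕ} {X Y : Type*} [AddCommGroup X] [Module 𝕜 X]
    [TopologicalSpace X] [AddCommGroup Y] [Module 𝕜 Y] [TopologicalSpace Y]
    [IsTopologicalAddGroup X] [ContinuousSMul 𝕜 X]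
    {f g : X → Y} {U : Set X} (hU : IsOpen U) (hf : CnOn 𝕜 n f U) (h : EqOn g f U) :
    CnOn 𝕜 n g U := by
  cases n with
  | zero => exact ContinuousOn.congr hf h
  | succ n =>
    obtain ⟨hc, df, h1, h2⟩ := hf
    refine ⟨hc.congr h, df, fun x hx v => (h1 x hx v).congr' ?_, h2⟩
    have : Tendsto (fun t : 𝕜 => x + t • v) (𝓝[≠] 0) (𝓝 x) := by
      have : Continuous (fun t : 𝕜 => x + t • v) := by fun_prop
      have := this.tendsto 0
      simp only [zero_smul, add_zero] at this
      exact this.mono_left nhdsWithin_le_nhds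
    filter_upwards [this (hU.mem_nhds hx)] with t ht
    rw [h hx, h ht]

/-- In a locally convex space, difference quotients of `C^1` maps converge along convergent
directions. -/
theorem tendsto_slope {Y Z : Type*} [AddCommGroup Y] [Module 𝕜 Y]
    [TopologicalSpace Y] [IsTopologicalAddGroup Y] [ContinuousSMul 𝕜 Y]
    [AddCommGroup Z] [Module 𝕜 Z] [TopologicalSpace Z] [IsTopologicalAddGroup Z]
    [ContinuousSMul 𝕜 Z] [PolynormableSpace 𝕜 Z]
    {g : Y → Z} {dg : Y × Y → Z} {V : Set Y} (hV : IsOpen V)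
    (hd : ∀ y ∈ V, ∀ h, HasDirDeriv 𝕜 g y h (dg (y, h)))
    (hc : ContinuousOn dg (V ×ˢ univ)) {y : Y} (hy : y ∈ V) {v : 𝕜 → Y} {v0 : Y}
    (hv : Tendsto v (𝓝[≠] 0) (𝓝 v0)) :
    Tendsto (fun t : 𝕜 => t⁻¹ • (g (y + t • v t) - g y)) (𝓝[≠] 0) (𝓝 (dg (y, v0))) := by
  let _ : Module ℝ Z := Module.compHom Z (algebraMap ℝ 𝕜)
  have : IsScalarTower ℝ 𝕜 Z := ⟨fun r a z => by
    rw [Algebra.smul_def, mul_smul]; rfl⟩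
  have hsm : ∀ (r : ℝ) (z : Z), r • z = (r : 𝕜) • z := fun r z => rfl
  have hws := PolynormableSpace.withSeminorms 𝕜 Z
  have : LocallyConvexSpace ℝ Z := hws.toLocallyConvexSpace
  have : ContinuousSMul ℝ Z := IsScalarTower.continuousSMul (M := ℝ) (α := Z) 𝕜
  have hbasis := (closed_nhds_basis (dg (y, v0)))
  rw [hbasis.tendsto_right_iff]
  rintro K ⟨hK, hKc⟩
  obtain ⟨C, ⟨hC, hCconv⟩, hCK⟩ := (LocallyConvexSpace.convex_basis (𝕜 := ℝ) (dg (y, v0))).mem_iff.1 hK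
  simp only [id] at hCK
  -- neighbourhoods on which the derivative stays in `C`
  have hcat : ContinuousAt dg (y, v0) :=
    hc.continuousAt ((hV.prod isOpen_univ).mem_nhds ⟨hy, trivial⟩)
  have h1 : ∀ᶠ p in 𝓝 (y, v0), dg p ∈ C ∧ p.1 ∈ V :=
    (hcat.eventually_mem hC).and (continuousAt_fst.eventually_mem (hV.mem_nhds hy))
  rw [nhds_prod_eq, eventually_prod_iff] at h1
  obtain ⟨pa, hpa, pb, hpb, hab⟩ := h1
  have hpa' : ∀ᶠ w in 𝓝 (0 : Y), pa (y + w) := by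
    have : Tendsto (fun w => y + w) (𝓝 (0 : Y)) (𝓝 y) := by
      have : Continuous (fun w => y + w) := by fun_prop
      simpa using this.tendsto 0
    exact this hpa
  obtain ⟨D, ⟨hD, hDb⟩, hDs⟩ := (nhds_basis_balanced 𝕜 Y).mem_iff.1 hpa'
  simp only [id] at hDs
  have htv : Tendsto (fun t : 𝕜 => t • v t) (𝓝[≠] 0) (𝓝 0) := by
    have : Tendsto (fun t : 𝕜 => t) (𝓝[≠] 0) (𝓝 0) := nhdsWithin_le_nhds
    simpa using this.smul hv
  filter_upwards [htv hD, hv hpb, self_mem_nhdsWithin] with t htD htb ht0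
  have ht0 : t ≠ 0 := ht0
  by_contra hnot
  have hCcl : closure C ⊆ K := closure_minimal hCK hKc
  obtain ⟨l, u, hl, hu⟩ := RCLike.geometric_hahn_banach_closed_point (𝕜 := 𝕜)
    hCconv.closure isClosed_closure (fun h => hnot (hCcl h))
  have hmem : ∀ s ∈ Icc (0 : ℝ) 1, pa (y + (s : 𝕜) • (t • v t)) := by
    intro s hs
    apply hDs
    refine hDb.smul_mem ?_ htD
    simp [abs_le]; constructor <;> linarith [hs.1, hs.2]
  let ψ : ℝ → ℝ := fun s => RCLike.re (l (t⁻¹ • (g (y + (s : 𝕜) • (t • v t)))))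
  have hder : ∀ s ∈ Icc (0 : ℝ) 1,
      HasDerivAt ψ (RCLike.re (l (dg (y + (s : 𝕜) • (t • v t), v t)))) s := by
    intro s hs
    rw [hasDerivAt_iff_tendsto_slope_zero]
    have hxV := (hab (hmem s hs) htb).2
    have h2 := hd _ hxV (v t)
    have h3 : Tendsto (fun r : ℝ => (r : 𝕜) * t) (𝓝[≠] 0) (𝓝[≠] 0) := by
      refine tendsto_nhdsWithin_iff.2 ⟨?_, ?_⟩
      · have : Continuous (fun r : ℝ => (r : 𝕜) * t) :=
          (RCLike.continuous_ofReal).mul continuous_const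
        have := this.tendsto 0
        simp only [RCLike.ofReal_zero, zero_mul] at this
        exact this.mono_left nhdsWithin_le_nhds
      · filter_upwards [self_mem_nhdsWithin] with r hr
        have hr : r ≠ 0 := hr
        simp [hr, ht0]
    have h4 := ((RCLike.continuous_re.comp l.continuous).tendsto _).comp (h2.comp h3)
    refine h4.congr fun r => ?_
    simp only [Function.comp_apply, ψ, smul_eq_mul]
    have e1 : (((r : 𝕜) * t)⁻¹) = ((r⁻¹ : ℝ) : 𝕜) * t⁻¹ := by
      rw [mul_inv]; simp
    have e2 : y + (s : 𝕜) • t • v t + ((r : 𝕜) * t) • v t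
        = y + ((s + r : ℝ) : 𝕜) • t • v t := by
      simp only [RCLike.ofReal_add]; module
    rw [← map_sub, ← map_sub, ← smul_sub, ← RCLike.re_ofReal_mul, ← smul_eq_mul (_ : 𝕜) (l _),
      ← map_smul]
    rw [e1, e2, mul_smul]
  obtain ⟨ξ, hξ, hslope⟩ := exists_hasDerivAt_eq_slope ψ
    (fun s => RCLike.re (l (dg (y + (s : 𝕜) • (t • v t), v t)))) zero_lt_one
    (fun s hs => (hder s hs).continuousAt.continuousWithinAt)
    (fun s hs => hder s (Ioo_subset_Icc_self hs))
  have h5 := hl _ (subset_closure (hab (hmem ξ (Ioo_subset_Icc_self hξ)) htb).1)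
  simp only [sub_zero, div_one] at hslope
  rw [hslope] at h5
  simp only [ψ, RCLike.ofReal_one, one_smul, RCLike.ofReal_zero, zero_smul, add_zero] at h5
  rw [← map_sub, ← map_sub, ← smul_sub] at h5
  exact absurd h5 (not_lt.2 hu.le)

theorem CnOn.comp {n : ℕ} : ∀ {X : Type*} {Y : Type*} {Z : Type*}
    [AddCommGroup X] [Module 𝕜 X] [TopologicalSpace X]
    [AddCommGroup Y] [Module 𝕜 Y] [TopologicalSpace Y]
    [IsTopologicalAddGroup Y] [ContinuousSMul 𝕜 Y]
    [AddCommGroup Z] [Module 𝕜 Z] [TopologicalSpace Z] [IsTopologicalAddGroup Z]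
    [ContinuousSMul 𝕜 Z] [PolynormableSpace 𝕜 Z]
    {g : Y → Z} {f : X → Y} {V : Set Y} {U : Set X}, IsOpen V → CnOn 𝕜 n g V → CnOn 𝕜 n f U →
    MapsTo f U V → CnOn 𝕜 n (g ∘ f) U := by
  induction n with
  | zero =>
    intro X Y Z _ _ _ _ _ _ _ _ _ _ _ _ _ _ g f V U hV hg hf hm
    exact ContinuousOn.comp hg hf hm
  | succ n ih =>
    intro X Y Z _ _ _ _ _ _ _ _ _ _ _ _ _ _ g f V U hV hg hf hm
    have hfn := hf.of_succ
    obtain ⟨hfc, df, f1, f2⟩ := hf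
    obtain ⟨hgc, dg, g1, g2⟩ := hg
    refine ⟨hgc.comp hfc hm, dg ∘ (fun p : X × X => (f p.1, df p)), fun x hx h => ?_, ?_⟩
    · have := tendsto_slope hV g1 g2.continuousOn (hm hx) (f1 x hx h)
      refine this.congr' ?_
      filter_upwards [self_mem_nhdsWithin] with t ht
      have ht : t ≠ 0 := ht
      simp [smul_smul, ht]
    · refine ih (hV.prod isOpen_univ) g2 (CnOn.prodMk ?_ f2) fun p hp => ⟨hm hp.1, trivial⟩
      exact (hfn.comp_clm (ContinuousLinearMap.fst 𝕜 X X)).mono fun p hp => hp.1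

end CalculusLemmas

section Manifold

/-- The product of two charted spaces, with the products of charts as atlas. -/
instance prodChart (E M F M' : Type*) [TopologicalSpace E] [TopologicalSpace M]
    [ChartedSpace E M] [TopologicalSpace F] [TopologicalSpace M'] [ChartedSpace F M'] :
    ChartedSpace (E × F) (M × M') where
  atlas := image2 OpenPartialHomeomorph.prod (atlas E M) (atlas F M')
  chartAt x := (chartAt E x.1).prod (chartAt F x.2)
  mem_chart_source x := ⟨mem_chart_source E x.1, mem_chart_source F x.2⟩
  chart_mem_atlas x := mem_image2_of_mem (chart_mem_atlas E x.1) (chart_mem_atlas F x.2)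

variable (𝕜 : Type*) [RCLike 𝕜]

/-- `M`, with its charts in the locally convex space `E`, is a smooth manifold: all changes of
charts are smooth. -/
class SmoothManifold (E : Type*) [AddCommGroup E] [Module 𝕜 E] [TopologicalSpace E]
    (M : Type*) [TopologicalSpace M] [ChartedSpace E M] : Prop where
  compatible : ∀ e ∈ atlas E M, ∀ e' ∈ atlas E M,
    SmoothOnOpen 𝕜 (e' ∘ e.symm) (e.target ∩ e.symm ⁻¹' e'.source)

section

variable (E F : Type*) [AddCommGroup E] [Module 𝕜 E] [TopologicalSpace E]
  [AddCommGroup F] [Module 𝕜 F] [TopologicalSpace F]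
  {M M' : Type*} [TopologicalSpace M] [ChartedSpace E M] [TopologicalSpace M'] [ChartedSpace F M']

/-- `f : M → M'` is smooth near `x`: in suitable charts of the two manifolds, `f` is smooth on an
open neighbourhood of the point corresponding to `x`. -/
def SmoothNear (f : M → M') (x : M) : Prop :=
  ∃ e ∈ atlas E M, ∃ e' ∈ atlas F M', x ∈ e.source ∧ ∃ O : Set E, IsOpen O ∧ O ⊆ e.target ∧
    e x ∈ O ∧ MapsTo (f ∘ e.symm) O e'.source ∧ SmoothOnOpen 𝕜 (e' ∘ f ∘ e.symm) O

/-- `f` is smooth on the open set `U`. -/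
def SmoothOnSet (f : M → M') (U : Set M) : Prop := ∀ x ∈ U, SmoothNear 𝕜 E F f x

/-- `f` is smooth. -/
def SmoothMap (f : M → M') : Prop := ∀ x, SmoothNear 𝕜 E F f x

/-- `f` is smooth on some open neighbourhood of `x`. -/
def LocallySmoothAt (f : M → M') (x : M) : Prop :=
  ∃ U : Set M, IsOpen U ∧ x ∈ U ∧ SmoothOnSet 𝕜 E F f U

end

section Lemmas

variable {𝕜}
variable {E F H : Type*} [AddCommGroup E] [Module 𝕜 E] [TopologicalSpace E]
  [AddCommGroup F] [Module 𝕜 F] [TopologicalSpace F]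
  [AddCommGroup H] [Module 𝕜 H] [TopologicalSpace H]
  {M M' M'' : Type*} [TopologicalSpace M] [ChartedSpace E M] [TopologicalSpace M']
  [ChartedSpace F M'] [TopologicalSpace M''] [ChartedSpace H M'']

theorem SmoothNear.eventually {f : M → M'} {x : M} (h : SmoothNear 𝕜 E F f x) :
    ∃ U : Set M, IsOpen U ∧ x ∈ U ∧ SmoothOnSet 𝕜 E F f U := by
  obtain ⟨e, he, e', he', hx, O, hO, hOt, hxO, hm, hs⟩ := h
  refine ⟨e.source ∩ e ⁻¹' O, e.isOpen_inter_preimage hO, ⟨hx, hxO⟩, fun y hy => ?_⟩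
  exact ⟨e, he, e', he', hy.1, O, hO, hOt, hy.2, hm, hs⟩

theorem locallySmoothAt_iff {f : M → M'} {x : M} :
    LocallySmoothAt 𝕜 E F f x ↔ SmoothNear 𝕜 E F f x :=
  ⟨fun ⟨_, _, hx, h⟩ => h x hx, fun h => h.eventually⟩

theorem SmoothNear.continuousAt {f : M → M'} {x : M} (h : SmoothNear 𝕜 E F f x) :
    ContinuousAt f x := by
  obtain ⟨e, he, e', he', hx, O, hO, hOt, hxO, hm, hs⟩ := h
  have h1 : ContinuousAt (e' ∘ f ∘ e.symm) (e x) :=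
    ((hs 0).continuousOn).continuousAt (hO.mem_nhds hxO)
  have h2 : f x ∈ e'.source := by simpa [hx] using hm hxO
  have h3 : ContinuousAt e'.symm ((e' ∘ f ∘ e.symm) (e x)) := by
    apply e'.continuousAt_symm
    simpa [hx] using e'.map_source h2
  have h4 : ContinuousAt ((e'.symm ∘ (e' ∘ f ∘ e.symm)) ∘ e) x :=
    (ContinuousAt.comp h3 h1).comp (e.continuousAt hx)
  refine h4.congr ?_
  filter_upwards [(e.isOpen_inter_preimage hO).mem_nhds ⟨hx, hxO⟩] with y hy
  have := hm hy.2
  simp only [Function.comp_apply, e.left_inv hy.1] at this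
  simp [e.left_inv hy.1, e'.left_inv this]

theorem SmoothNear.congr [IsTopologicalAddGroup E] [ContinuousSMul 𝕜 E] {f g : M → M'} {x : M}
    (h : SmoothNear 𝕜 E F f x) (hfg : f =ᶠ[𝓝 x] g) : SmoothNear 𝕜 E F g x := by
  obtain ⟨e, he, e', he', hx, O, hO, hOt, hxO, hm, hs⟩ := h
  obtain ⟨W, hW, hWo, hxW⟩ := mem_nhds_iff.1 hfg
  have hO' : IsOpen (e.target ∩ e.symm ⁻¹' W) := e.isOpen_inter_preimage_symm hWo
  have heq : ∀ u ∈ e.target ∩ e.symm ⁻¹' W, f (e.symm u) = g (e.symm u) := fun u hu => hW hu.2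
  refine ⟨e, he, e', he', hx, O ∩ (e.target ∩ e.symm ⁻¹' W), hO.inter hO',
    inter_subset_left.trans hOt, ⟨hxO, e.map_source hx, by simpa [hx] using hxW⟩, ?_, fun n => ?_⟩
  · intro u hu
    have := hm hu.1
    simpa [heq u hu.2] using this
  · refine ((hs n).mono inter_subset_left).congr (hO.inter hO') fun u hu => ?_
    simp [heq u hu.2]

theorem SmoothNear.comp [IsTopologicalAddGroup E] [ContinuousSMul 𝕜 E]
    [IsTopologicalAddGroup F] [ContinuousSMul 𝕜 F]
    [IsTopologicalAddGroup H] [ContinuousSMul 𝕜 H] [PolynormableSpace 𝕜 H]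
    [SmoothManifold 𝕜 F M'] {g : M' → M''} {f : M → M'} {x : M}
    (hg : SmoothNear 𝕜 F H g (f x)) (hf : SmoothNear 𝕜 E F f x) :
    SmoothNear 𝕜 E H (fun y => g (f y)) x := by
  obtain ⟨e, he, e', he', hx, O, hO, hOt, hxO, hm, hs⟩ := hf
  obtain ⟨d, hd, d', hd', hy, P, hP, hPt, hyP, hm', hs'⟩ := hg
  have hfx : f x ∈ e'.source := by simpa [hx] using hm hxO
  have htr := SmoothManifold.compatible (𝕜 := 𝕜) e' he' d hd
  have hTo : IsOpen (e'.target ∩ e'.symm ⁻¹' d.source) := e'.isOpen_inter_preimage_symm d.open_source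
  have hT1 := ((htr 0).continuousOn).isOpen_inter_preimage hTo hP
  have hg1 := fun n => (hs' n).comp hP ((htr n).mono inter_subset_left) fun u hu => hu.2
  have hO1 := ((hs 0).continuousOn).isOpen_inter_preimage hO hT1
  have key : ∀ u ∈ O, e'.symm (e' (f (e.symm u))) = f (e.symm u) := fun u hu => e'.left_inv (hm hu)
  refine ⟨e, he, d', hd', hx, _, hO1, inter_subset_left.trans hOt,
    ⟨hxO, ⟨?_, ?_⟩, ?_⟩, ?_, fun n => ?_⟩
  · simpa [hx] using e'.map_source hfx
  · simpa [hx, hfx] using hy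
  · simpa [hx, hfx] using hyP
  · intro u hu
    have h1 := hm' hu.2.2
    have h2 : f (e.symm u) ∈ d.source := by simpa [key u hu.1] using hu.2.1.2
    simpa [key u hu.1, h2] using h1
  · have := (hg1 n).comp hT1 ((hs n).mono inter_subset_left) (fun u hu => hu.2)
    refine this.congr hO1 fun u hu => ?_
    have h2 : f (e.symm u) ∈ d.source := by simpa [key u hu.1] using hu.2.1.2
    simp [key u hu.1, h2]

/-- Smoothness near a point can be tested in any chart of the source. -/
theorem SmoothNear.exists_chart [IsTopologicalAddGroup E] [ContinuousSMul 𝕜 E]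
    [IsTopologicalAddGroup F] [ContinuousSMul 𝕜 F] [PolynormableSpace 𝕜 F]
    [SmoothManifold 𝕜 E M] {f : M → M'} {x : M} (hf : SmoothNear 𝕜 E F f x)
    {e : OpenPartialHomeomorph M E} (he : e ∈ atlas E M) (hx : x ∈ e.source) :
    ∃ e' ∈ atlas F M', ∃ O : Set E, IsOpen O ∧ O ⊆ e.target ∧
      e x ∈ O ∧ MapsTo (f ∘ e.symm) O e'.source ∧ SmoothOnOpen 𝕜 (e' ∘ f ∘ e.symm) O := by
  obtain ⟨d, hd, e', he', hxd, O, hO, hOt, hxO, hm, hs⟩ := hf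
  have htr := SmoothManifold.compatible (𝕜 := 𝕜) e he d hd
  have hTo : IsOpen (e.target ∩ e.symm ⁻¹' d.source) := e.isOpen_inter_preimage_symm d.open_source
  have hT1 := ((htr 0).continuousOn).isOpen_inter_preimage hTo hO
  refine ⟨e', he', _, hT1, inter_subset_left.trans inter_subset_left,
    ⟨⟨e.map_source hx, by simpa [hx] using hxd⟩, by simpa [hx] using hxO⟩, fun u hu => ?_,
    fun n => ?_⟩
  · have h := hm hu.2
    have h2 : e.symm u ∈ d.source := hu.1.2
    simpa [h2] using h
  · refine ((hs n).comp hO ((htr n).mono inter_subset_left) (fun u hu => hu.2)).congr hT1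
      fun u hu => ?_
    have h2 : e.symm u ∈ d.source := hu.1.2
    simp [h2]

theorem SmoothNear.prodMk [IsTopologicalAddGroup E] [ContinuousSMul 𝕜 E]
    [IsTopologicalAddGroup F] [ContinuousSMul 𝕜 F] [PolynormableSpace 𝕜 F]
    [IsTopologicalAddGroup H] [ContinuousSMul 𝕜 H] [PolynormableSpace 𝕜 H]
    [SmoothManifold 𝕜 E M] {f : M → M'} {g : M → M''} {x : M}
    (hf : SmoothNear 𝕜 E F f x) (hg : SmoothNear 𝕜 E H g x) :
    SmoothNear 𝕜 E (F × H) (fun y => (f y, g y)) x := by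
  obtain ⟨e, he, e', he', hx, O, hO, hOt, hxO, hm, hs⟩ := hf
  obtain ⟨d', hd', P, hP, hPt, hxP, hm', hs'⟩ := hg.exists_chart he hx
  exact ⟨e, he, e'.prod d', mem_image2_of_mem he' hd', hx, O ∩ P, hO.inter hP,
    inter_subset_left.trans hOt, ⟨hxO, hxP⟩, fun u hu => ⟨hm hu.1, hm' hu.2⟩, fun n =>
    ((hs n).mono inter_subset_left).prodMk ((hs' n).mono inter_subset_right)⟩

theorem SmoothNear.id [IsTopologicalAddGroup E] [ContinuousSMul 𝕜 E] (x : M) :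
    SmoothNear 𝕜 E E (fun y : M => y) x := by
  refine ⟨chartAt E x, chart_mem_atlas E x, chartAt E x, chart_mem_atlas E x,
    mem_chart_source E x, (chartAt E x).target, (chartAt E x).open_target,
    subset_rfl, mem_chart_target E x, fun u hu => (chartAt E x).map_target hu, fun n => ?_⟩
  refine (cnOn_clm (ContinuousLinearMap.id 𝕜 E) _).congr (chartAt E x).open_target fun u hu => ?_
  exact (chartAt E x).right_inv hu

theorem SmoothNear.const (c : M') (x : M) : SmoothNear 𝕜 E F (fun _ : M => c) x := by
  refine ⟨chartAt E x, chart_mem_atlas E x, chartAt F c, chart_mem_atlas F c,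
    mem_chart_source E x, (chartAt E x).target, (chartAt E x).open_target, subset_rfl,
    mem_chart_target E x, fun u hu => mem_chart_source F c, fun n => ?_⟩
  exact cnOn_const (chartAt F c c) _

theorem SmoothNear.fst [IsTopologicalAddGroup E] [ContinuousSMul 𝕜 E]
    [IsTopologicalAddGroup F] [ContinuousSMul 𝕜 F] (p : M × M') :
    SmoothNear 𝕜 (E × F) E (Prod.fst : M × M' → M) p := by
  refine ⟨chartAt (E × F) p, chart_mem_atlas _ p, chartAt E p.1, chart_mem_atlas E p.1,
    mem_chart_source _ p, (chartAt (E × F) p).target, (chartAt (E × F) p).open_target, subset_rfl,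
    mem_chart_target _ p, fun u hu => ?_, fun n => ?_⟩
  · exact ((chartAt (E × F) p).map_target hu).1
  · refine (cnOn_clm (ContinuousLinearMap.fst 𝕜 E F) _).congr (chartAt (E × F) p).open_target
      fun u hu => ?_
    exact ((chartAt E p.1).right_inv hu.1)

theorem SmoothNear.snd [IsTopologicalAddGroup E] [ContinuousSMul 𝕜 E]
    [IsTopologicalAddGroup F] [ContinuousSMul 𝕜 F] (p : M × M') :
    SmoothNear 𝕜 (E × F) F (Prod.snd : M × M' → M') p := by
  refine ⟨chartAt (E × F) p, chart_mem_atlas _ p, chartAt F p.2, chart_mem_atlas F p.2,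
    mem_chart_source _ p, (chartAt (E × F) p).target, (chartAt (E × F) p).open_target, subset_rfl,
    mem_chart_target _ p, fun u hu => ?_, fun n => ?_⟩
  · exact ((chartAt (E × F) p).map_target hu).2
  · refine (cnOn_clm (ContinuousLinearMap.snd 𝕜 E F) _).congr (chartAt (E × F) p).open_target
      fun u hu => ?_
    exact ((chartAt F p.2).right_inv hu.2)

instance SmoothManifold.prod [SmoothManifold 𝕜 E M] [SmoothManifold 𝕜 F M'] :
    SmoothManifold 𝕜 (E × F) (M × M') where
  compatible := by
    rintro _ ⟨e, he, d, hd, rfl⟩ _ ⟨e', he', d', hd', rfl⟩ n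
    have h1 := (SmoothManifold.compatible (𝕜 := 𝕜) e he e' he' n).comp_clm
      (ContinuousLinearMap.fst 𝕜 E F)
    have h2 := (SmoothManifold.compatible (𝕜 := 𝕜) d hd d' hd' n).comp_clm
      (ContinuousLinearMap.snd 𝕜 E F)
    refine (h1.mono ?_).prodMk (h2.mono ?_)
    · exact fun p hp => ⟨hp.1.1, hp.2.1⟩
    · exact fun p hp => ⟨hp.1.2, hp.2.2⟩

end Lemmas
end Manifold

section LieGroups

/-- A Lie group modelled on the locally convex space `E` over `𝕜`. -/
class LocConvLieGroup (𝕜 : Type*) [RCLike 𝕜] (E : Type*) [AddCommGroup E] [Module 𝕜 E]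
    [TopologicalSpace E] (G : Type*) [Group G] [TopologicalSpace G] [ChartedSpace E G] : Prop
    extends SmoothManifold 𝕜 E G where
  smooth_mul : SmoothMap 𝕜 (E × E) E (fun p : G × G => p.1 * p.2)
  smooth_inv : SmoothMap 𝕜 E E (fun g : G => g⁻¹)

section Lemmas


variable {𝕜 : Type*} [RCLike 𝕜]
  {E : Type*} [AddCommGroup E] [Module 𝕜 E] [TopologicalSpace E] [IsTopologicalAddGroup E]
  [ContinuousSMul 𝕜 E]
  {M : Type*} [TopologicalSpace M] [ChartedSpace E M] [SmoothManifold 𝕜 E M]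
  {F : Type*} [AddCommGroup F] [Module 𝕜 F] [TopologicalSpace F] [IsTopologicalAddGroup F]
  [ContinuousSMul 𝕜 F] [PolynormableSpace 𝕜 F]
  {H : Type*} [Group H] [TopologicalSpace H] [ChartedSpace F H] [LocConvLieGroup 𝕜 F H]

theorem SmoothNear.mul {f g : M → H} {x : M}
    (hf : SmoothNear 𝕜 E F f x) (hg : SmoothNear 𝕜 E F g x) :
    SmoothNear 𝕜 E F (fun y => f y * g y) x :=
  SmoothNear.comp (F := F × F) (g := fun p : H × H => p.1 * p.2) (f := fun y => (f y, g y))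
    (LocConvLieGroup.smooth_mul (𝕜 := 𝕜) (E := F) (f x, g x)) (hf.prodMk hg)

theorem SmoothNear.inv {f : M → H} {x : M} (hf : SmoothNear 𝕜 E F f x) :
    SmoothNear 𝕜 E F (fun y => (f y)⁻¹) x :=
  SmoothNear.comp (F := F) (g := fun p : H => p⁻¹) (LocConvLieGroup.smooth_inv (𝕜 := 𝕜) (E := F) (f x)) hf

end Lemmas

end LieGroups

section Algebra

variable {G N : Type*} [Group G] [Group N]

/-- `δ_S(g, g') = S(g) S(g') S(gg')⁻¹`. -/
def deltaAut (S : G → MulAut N) (g g' : G) : MulAut N := S g * S g' * (S (g * g'))⁻¹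

/-- `(d_S ω)(g, g', g'') = S(g)(ω(g', g'')) ω(g, g'g'') ω(gg', g'')⁻¹ ω(g, g')⁻¹`. -/
def d2 (S : G → MulAut N) (ω : G × G → N) (g g' g'' : G) : N :=
  S g (ω (g', g'')) * ω (g, g' * g'') * (ω (g * g', g''))⁻¹ * (ω (g, g'))⁻¹

/-- `(d_S α)(g, g') = S(g)(α(g')) α(gg')⁻¹ α(g)`. -/
def d1 (S : G → MulAut N) (α : G → N) (g g' : G) : N :=
  S g (α g') * (α (g * g'))⁻¹ * α g

theorem map_center (φ : MulAut N) {z : N} (hz : z ∈ Subgroup.center N) :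
    φ z ∈ Subgroup.center N := by
  rw [Subgroup.mem_center_iff] at *
  intro n
  obtain ⟨m, rfl⟩ := φ.surjective n
  rw [← map_mul, hz, map_mul]

instance centerCommGroup : CommGroup (Subgroup.center N) :=
  { (inferInstance : Group (Subgroup.center N)) with
    mul_comm := fun a b => Subtype.ext (Subgroup.mem_center_iff.1 b.2 a) }

/-- `S(g)`, restricted to the centre. -/
def centerMap (φ : MulAut N) : Subgroup.center N →* Subgroup.center N :=
  (φ.toMonoidHom.comp (Subgroup.center N).subtype).codRestrict (Subgroup.center N)
    fun z => map_center φ z.2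

end Algebra

section Cochains

variable (𝕜 : Type*) [RCLike 𝕜]
  (EG : Type*) [AddCommGroup EG] [Module 𝕜 EG] [TopologicalSpace EG]
  {G : Type*} [Group G] [TopologicalSpace G] [ChartedSpace EG G]
  (EN : Type*) [AddCommGroup EN] [Module 𝕜 EN] [TopologicalSpace EN]
  {N : Type*} [Group N] [TopologicalSpace N] [ChartedSpace EN N]

/-- `f ∈ C¹_s(G, N)`: `f` is normalized and smooth on an open identity neighbourhood. -/
def IsC1 (f : G → N) : Prop := f 1 = 1 ∧ LocallySmoothAt 𝕜 EG EN f 1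

/-- `ω ∈ C²_s(G, N)`. -/
def IsC2 (ω : G × G → N) : Prop :=
  (∀ g, ω (g, 1) = 1) ∧ (∀ g, ω (1, g) = 1) ∧ LocallySmoothAt 𝕜 (EG × EG) EN ω 1

/-- `ω ∈ C²_ss(G, N)`: moreover every `ω_g(x) = ω(g, x) ω(g x g⁻¹, g)⁻¹` is smooth on an open
identity neighbourhood. -/
def IsC2ss (ω : G × G → N) : Prop :=
  IsC2 𝕜 EG EN ω ∧
    ∀ g : G, LocallySmoothAt 𝕜 EG EN (fun x => ω (g, x) * (ω (g * x * g⁻¹, g))⁻¹) 1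

/-- `φ` is an automorphism of the Lie group `N`. -/
def IsLieAut (φ : MulAut N) : Prop := SmoothMap 𝕜 EN EN φ ∧ SmoothMap 𝕜 EN EN φ.symm

/-- `S ∈ C¹_s(G, Aut(N))`. -/
structure IsC1Aut (S : G → MulAut N) : Prop where
  lieAut : ∀ g, IsLieAut 𝕜 EN (S g)
  map_one : S 1 = 1
  locallySmooth : ∃ U : Set G, IsOpen U ∧ 1 ∈ U ∧
    SmoothOnSet 𝕜 (EG × EN) EN (fun p : G × N => S p.1 p.2) (U ×ˢ univ)

/-- `S` is a smooth outer action of `G` on `N`. -/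
def IsSmoothOuterAction (S : G → MulAut N) : Prop :=
  IsC1Aut 𝕜 EG EN S ∧
    ∃ ω : G × G → N, IsC2 𝕜 EG EN ω ∧ ∀ g g', deltaAut S g g' = MulAut.conj (ω (g, g'))

/-- The equivalence `S ∼ S'` of smooth outer actions; its classes are the smooth `G`-kernels. -/
def OuterEquiv (S S' : G → MulAut N) : Prop :=
  ∃ h : G → N, IsC1 𝕜 EG EN h ∧ ∀ g, S' g = MulAut.conj (h g) * S g

end Cochains

section Cohomology


variable (𝕜 : Type*) [RCLike 𝕜]
  (EG : Type*) [AddCommGroup EG] [Module 𝕜 EG] [TopologicalSpace EG] [IsTopologicalAddGroup EG]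
  [ContinuousSMul 𝕜 EG]
  {G : Type*} [Group G] [TopologicalSpace G] [ChartedSpace EG G] [LocConvLieGroup 𝕜 EG G]
  (EN : Type*) [AddCommGroup EN] [Module 𝕜 EN] [TopologicalSpace EN] [IsTopologicalAddGroup EN]
  [ContinuousSMul 𝕜 EN] [PolynormableSpace 𝕜 EN]
  {N : Type*} [Group N] [TopologicalSpace N] [ChartedSpace EN N] [LocConvLieGroup 𝕜 EN N]

variable {𝕜 EG EN}

theorem isC2ss_iff {ω : G × G → N} : IsC2ss 𝕜 EG EN ω ↔ (∀ g, ω (g, 1) = 1) ∧ 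
    (∀ g, ω (1, g) = 1) ∧ SmoothNear 𝕜 (EG × EG) EN ω 1 ∧
    ∀ g : G, SmoothNear 𝕜 EG EN (fun x => ω (g, x) * (ω (g * x * g⁻¹, g))⁻¹) 1 := by
  simp only [IsC2ss, IsC2, locallySmoothAt_iff, and_assoc]

/-- The product of a cochain in `C²_ss(G, N)` with one in `C²_ss(G, Z(N))` is in `C²_ss(G, N)`. -/
theorem IsC2ss.mul_central {ω β : G × G → N} (hω : IsC2ss 𝕜 EG EN ω) (hβ : IsC2ss 𝕜 EG EN β)
    (hc : ∀ p, β p ∈ Subgroup.center N) : IsC2ss 𝕜 EG EN (fun p => ω p * β p) := by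
  rw [isC2ss_iff] at *
  obtain ⟨h1, h2, h3, h4⟩ := hω
  obtain ⟨k1, k2, k3, k4⟩ := hβ
  refine ⟨fun g => by simp [h1, k1], fun g => by simp [h2, k2], h3.mul k3, fun g => ?_⟩
  have : (fun x => ω (g, x) * β (g, x) * (ω (g * x * g⁻¹, g) * β (g * x * g⁻¹, g))⁻¹) =
      fun x => (ω (g, x) * (ω (g * x * g⁻¹, g))⁻¹) * (β (g, x) * (β (g * x * g⁻¹, g))⁻¹) := by
    funext x
    have e := Subgroup.mem_center_iff.1 (mul_mem (hc (g, x)) (inv_mem (hc (g * x * g⁻¹, g))))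
      (ω (g * x * g⁻¹, g))⁻¹
    rw [mul_inv_rev, mul_assoc, ← mul_assoc (β _), ← e, ← mul_assoc]
  rw [this]
  exact (h4 g).mul (k4 g)

theorem IsC2ss.inv_central {β : G × G → N} (hβ : IsC2ss 𝕜 EG EN β)
    (hc : ∀ p, β p ∈ Subgroup.center N) : IsC2ss 𝕜 EG EN (fun p => (β p)⁻¹) := by
  rw [isC2ss_iff] at *
  obtain ⟨k1, k2, k3, k4⟩ := hβ
  refine ⟨fun g => by simp [k1], fun g => by simp [k2], k3.inv, fun g => ?_⟩
  have : (fun x => (β (g, x))⁻¹ * ((β (g * x * g⁻¹, g))⁻¹)⁻¹) =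
      fun x => (β (g, x) * (β (g * x * g⁻¹, g))⁻¹)⁻¹ := by
    funext x
    rw [mul_inv_rev, Subgroup.mem_center_iff.1 (inv_mem (hc (g, x)))]
  rw [this]
  exact (k4 g).inv

variable (𝕜 EG EN)

/-- `Z²_ss(G, Z(N))_S`. -/
def Z2ss (S : G → MulAut N) : Subgroup (G × G → Subgroup.center N) where
  carrier := {β | IsC2ss 𝕜 EG EN (fun p => (β p : N)) ∧
    ∀ g g' g'', d2 S (fun p => (β p : N)) g g' g'' = 1}
  one_mem' := by
    refine ⟨isC2ss_iff.2 ⟨by simp, by simp, by simpa using SmoothNear.const _ _,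
      by simpa using SmoothNear.const _ _⟩, by simp [d2]⟩
  mul_mem' := by
    rintro a b ⟨ha, ha'⟩ ⟨hb, hb'⟩
    refine ⟨by simpa using ha.mul_central hb fun p => (b p).2, fun g g' g'' => ?_⟩
    have e1 : centerMap (S g) (a (g', g'')) * a (g, g' * g'') * (a (g * g', g''))⁻¹ * (a (g, g'))⁻¹
      = 1 := Subtype.ext (ha' g g' g'')
    have e2 : centerMap (S g) (b (g', g'')) * b (g, g' * g'') * (b (g * g', g''))⁻¹ * (b (g, g'))⁻¹
      = 1 := Subtype.ext (hb' g g' g'')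
    have e3 : centerMap (S g) ((a * b) (g', g'')) * (a * b) (g, g' * g'') *
        ((a * b) (g * g', g''))⁻¹ * ((a * b) (g, g'))⁻¹ = 1 := by
      rw [← mul_one (1 : Subgroup.center N)]
      nth_rewrite 1 [← e1]
      rw [← e2]
      simp only [Pi.mul_apply, map_mul, mul_inv]
      simp only [mul_comm, mul_left_comm, mul_assoc]
    exact congrArg Subtype.val e3
  inv_mem' := by
    rintro a ⟨ha, ha'⟩
    refine ⟨by simpa using ha.inv_central fun p => (a p).2, fun g g' g'' => ?_⟩
    have e1 : centerMap (S g) (a (g', g'')) * a (g, g' * g'') * (a (g * g', g''))⁻¹ * (a (g, g'))⁻¹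
      = 1 := Subtype.ext (ha' g g' g'')
    have e3 : centerMap (S g) (a⁻¹ (g', g'')) * a⁻¹ (g, g' * g'') *
        (a⁻¹ (g * g', g''))⁻¹ * (a⁻¹ (g, g'))⁻¹ = 1 := by
      rw [← inv_one, ← e1]
      simp only [Pi.inv_apply, map_inv, mul_inv]
    exact congrArg Subtype.val e3

/-- `B²_s(G, Z(N))_S`. -/
def B2s (S : G → MulAut N) : Subgroup (G × G → Subgroup.center N) where
  carrier := {β | ∃ α : G → Subgroup.center N, IsC1 𝕜 EG EN (fun g => (α g : N)) ∧
    ∀ g g', (β (g, g') : N) = d1 S (fun g => (α g : N)) g g'}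
  one_mem' := ⟨1, ⟨by simp, locallySmoothAt_iff.2 (by simpa using SmoothNear.const _ _)⟩,
    by simp [d1]⟩
  mul_mem' := by
    rintro a b ⟨α, ⟨h1, h2⟩, h3⟩ ⟨β, ⟨k1, k2⟩, k3⟩
    rw [locallySmoothAt_iff] at h2 k2
    refine ⟨α * β, ⟨by simp [h1, k1], locallySmoothAt_iff.2 (by simpa using h2.mul k2)⟩, ?_⟩
    intro g g'
    have e1 : a (g, g') = centerMap (S g) (α g') * (α (g * g'))⁻¹ * α g := Subtype.ext (h3 g g')
    have e2 : b (g, g') = centerMap (S g) (β g') * (β (g * g'))⁻¹ * β g := Subtype.ext (k3 g g')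
    have e3 : (a * b) (g, g') =
        centerMap (S g) ((α * β) g') * ((α * β) (g * g'))⁻¹ * (α * β) g := by
      simp only [Pi.mul_apply, map_mul, mul_inv, e1, e2]
      simp only [mul_comm, mul_left_comm, mul_assoc]
    exact congrArg Subtype.val e3
  inv_mem' := by
    rintro a ⟨α, ⟨h1, h2⟩, h3⟩
    rw [locallySmoothAt_iff] at h2
    refine ⟨α⁻¹, ⟨by simp [h1], locallySmoothAt_iff.2 (by simpa using h2.inv)⟩, fun g g' => ?_⟩
    have e1 : a (g, g') = centerMap (S g) (α g') * (α (g * g'))⁻¹ * α g := Subtype.ext (h3 g g')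
    have e3 : a⁻¹ (g, g') = centerMap (S g) (α⁻¹ g') * (α⁻¹ (g * g'))⁻¹ * α⁻¹ g := by
      simp only [Pi.inv_apply, map_inv, e1, mul_inv]
    exact congrArg Subtype.val e3

/-- `H²_ss(G, Z(N))_S = Z²_ss(G, Z(N))_S / B²_s(G, Z(N))_S`. -/
abbrev H2ss (S : G → MulAut N) : Type _ :=
  Z2ss 𝕜 EG EN S ⧸ (B2s 𝕜 EG EN S).subgroupOf (Z2ss 𝕜 EG EN S)

end Cohomology

section Extensions


section IsLieExtension

variable (𝕜 : Type*) [RCLike 𝕜]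
  (EG : Type*) [AddCommGroup EG] [Module 𝕜 EG] [TopologicalSpace EG]
  {G : Type*} [Group G] [TopologicalSpace G] [ChartedSpace EG G]
  (EN : Type*) [AddCommGroup EN] [Module 𝕜 EN] [TopologicalSpace EN]
  {N : Type*} [Group N] [TopologicalSpace N] [ChartedSpace EN N]
  (EX : Type*) [AddCommGroup EX] [Module 𝕜 EX] [TopologicalSpace EX]
  {X : Type*} [Group X] [TopologicalSpace X] [ChartedSpace EX X]

/-- `1 → N → X → G → 1` is an extension of Lie groups: a short exact sequence of Lie group
morphisms for which `X` is a smooth principal `N`-bundle over `G`. The last field is the local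
triviality of this bundle: over some open `U ∋ g` there is a smooth section `σ` such that the smooth
bijection `U × N → q⁻¹(U)`, `(y, n) ↦ σ(y) ι(n)`, has a smooth inverse `x ↦ (q x, τ x)`. -/
structure IsLieExtension (ι : N →* X) (q : X →* G) : Prop where
  smooth_ι : SmoothMap 𝕜 EN EX ι
  smooth_q : SmoothMap 𝕜 EX EG q
  injective : Function.Injective ι
  exact : ι.range = q.ker
  surjective : Function.Surjective q
  principal : ∀ g : G, ∃ U : Set G, IsOpen U ∧ g ∈ U ∧
    ∃ σ : G → X, SmoothOnSet 𝕜 EG EX σ U ∧ (∀ y ∈ U, q (σ y) = y) ∧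
      ∃ τ : X → N, SmoothOnSet 𝕜 EX EN τ (q ⁻¹' U) ∧
        ∀ x ∈ q ⁻¹' U, x = σ (q x) * ι (τ x)

end IsLieExtension

variable (𝕜 : Type w) [RCLike 𝕜]
  (EG : Type u) [AddCommGroup EG] [Module 𝕜 EG] [TopologicalSpace EG]
  (G : Type u) [Group G] [TopologicalSpace G] [ChartedSpace EG G]
  (EN : Type v) [AddCommGroup EN] [Module 𝕜 EN] [TopologicalSpace EN]
  (N : Type v) [Group N] [TopologicalSpace N] [ChartedSpace EN N]

/-- A Lie group extension of `G` by `N`; the total group may be modelled on any locally convex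
space. -/
structure LieExtension where
  carrier : Type (max u v)
  model : Type (max u v)
  [addCommGroup : AddCommGroup model]
  [module : Module 𝕜 model]
  [topologicalSpaceModel : TopologicalSpace model]
  [isTopologicalAddGroup : IsTopologicalAddGroup model]
  [continuousSMul : ContinuousSMul 𝕜 model]
  [polynormableSpace : PolynormableSpace 𝕜 model]
  [t2Space : T2Space model]
  [group : Group carrier]
  [topologicalSpace : TopologicalSpace carrier]
  [chartedSpace : ChartedSpace model carrier]
  [lieGroup : LocConvLieGroup 𝕜 model carrier]
  ι : N →* carrier
  q : carrier →* G
  isLieExtension : IsLieExtension 𝕜 EG EN model ι q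

attribute [instance] LieExtension.addCommGroup LieExtension.module
  LieExtension.topologicalSpaceModel LieExtension.isTopologicalAddGroup LieExtension.continuousSMul
  LieExtension.polynormableSpace LieExtension.t2Space LieExtension.group
  LieExtension.topologicalSpace LieExtension.chartedSpace LieExtension.lieGroup

variable {𝕜 EG G EN N}

/-- Equivalence of extensions: there is a morphism of Lie groups which is the identity on `N` and
on `G`. -/
def LieExtension.Equivalent (X Y : LieExtension 𝕜 EG G EN N) : Prop :=
  ∃ φ : X.carrier →* Y.carrier, SmoothMap 𝕜 X.model Y.model φ ∧
    (∀ n, φ (X.ι n) = Y.ι n) ∧ ∀ x, Y.q (φ x) = X.q x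

section Equivalence

variable [IsTopologicalAddGroup EG] [ContinuousSMul 𝕜 EG] [PolynormableSpace 𝕜 EG]
  [LocConvLieGroup 𝕜 EG G] [IsTopologicalAddGroup EN] [ContinuousSMul 𝕜 EN]
  [PolynormableSpace 𝕜 EN] [LocConvLieGroup 𝕜 EN N]

theorem LieExtension.Equivalent.symm {X Y : LieExtension 𝕜 EG G EN N} (h : X.Equivalent Y) :
    Y.Equivalent X := by
  obtain ⟨φ, hφ, hι, hq⟩ := h
  have hX := X.isLieExtension
  have hY := Y.isLieExtension
  have kerX : ∀ x, X.q x = 1 → ∃ n, X.ι n = x := fun x hx => by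
    have : x ∈ X.ι.range := by rw [hX.exact]; exact hx
    exact this
  have kerY : ∀ x, Y.q x = 1 → ∃ n, Y.ι n = x := fun x hx => by
    have : x ∈ Y.ι.range := by rw [hY.exact]; exact hx
    exact this
  have hinj : Function.Injective φ := by
    rw [injective_iff_map_eq_one]
    intro x hx
    obtain ⟨n, rfl⟩ := kerX x (by rw [← hq, hx, map_one])
    rw [hι] at hx
    rw [hY.injective (hx.trans (map_one _).symm), map_one]
  have hsurj : Function.Surjective φ := by
    intro y
    obtain ⟨x, hx⟩ := hX.surjective (Y.q y)
    obtain ⟨n, hn⟩ := kerY ((φ x)⁻¹ * y) (by rw [map_mul, map_inv, hq, hx, inv_mul_cancel])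
    exact ⟨x * X.ι n, by rw [map_mul, hι, hn, mul_inv_cancel_left]⟩
  let Φ := MulEquiv.ofBijective φ ⟨hinj, hsurj⟩
  have hΦ : ∀ y, φ (Φ.symm y) = y := fun y => Φ.apply_symm_apply y
  refine ⟨Φ.symm.toMonoidHom, fun y => ?_, fun n => ?_, fun y => ?_⟩
  · obtain ⟨U, hU, hyU, σ, hσ, hσq, -⟩ := hX.principal (Y.q y)
    obtain ⟨V, hV, h1V, ρ, -, -, τ, hτ, hτρ⟩ := hY.principal 1
    have hYqc : Continuous Y.q := continuous_iff_continuousAt.2 fun z => (hY.smooth_q z).continuousAt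
    let z : Y.carrier → Y.carrier := fun y' => (φ (σ (Y.q y')))⁻¹ * y'
    have hz1 : ∀ y', Y.q y' ∈ U → Y.q (z y') = 1 := fun y' hy' => by
      simp only [z, map_mul, map_inv, hq, hσq _ hy', inv_mul_cancel]
    have hσs : SmoothNear 𝕜 Y.model X.model (fun y' => σ (Y.q y')) y :=
      SmoothNear.comp (F := EG) (g := σ) (hσ _ hyU) (hY.smooth_q y)
    have hzs : SmoothNear 𝕜 Y.model Y.model z y :=
      (SmoothNear.comp (F := X.model) (g := φ) (hφ _) hσs).inv.mul (SmoothNear.id y)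
    have hτs : SmoothNear 𝕜 Y.model EN (fun y' => τ (z y')) y :=
      SmoothNear.comp (F := Y.model) (g := τ)
        (hτ _ (by simpa [hz1 y hyU] using h1V)) hzs
    have hns : SmoothNear 𝕜 Y.model EN (fun y' => (τ 1)⁻¹ * τ (z y')) y :=
      (SmoothNear.const _ _).mul hτs
    have hψ : SmoothNear 𝕜 Y.model X.model
        (fun y' => σ (Y.q y') * X.ι ((τ 1)⁻¹ * τ (z y'))) y :=
      hσs.mul (SmoothNear.comp (F := EN) (g := X.ι) (hX.smooth_ι _) hns)
    refine hψ.congr ?_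
    filter_upwards [hYqc.continuousAt.preimage_mem_nhds (hU.mem_nhds hyU)] with y' hy'
    apply hinj
    have e1 := hτρ 1 (by simpa using h1V)
    have e2 := hτρ (z y') (by simpa [hz1 y' hy'] using h1V)
    rw [hz1 y' hy'] at e2
    rw [map_one] at e1
    have e3 : Y.ι ((τ 1)⁻¹ * τ (z y')) = z y' := by
      rw [map_mul, map_inv]
      nth_rewrite 2 [e2]
      rw [eq_comm, mul_eq_one_iff_eq_inv] at e1
      rw [e1]
    change φ _ = φ (Φ.symm y')
    rw [hΦ, map_mul, hι, e3]
    simp [z]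
  · apply hinj
    change φ (Φ.symm _) = _
    rw [hΦ, hι]
  · change X.q (Φ.symm y) = _
    rw [← hq, hΦ]

variable (𝕜 EG G EN N)

instance LieExtension.setoid : Setoid (LieExtension 𝕜 EG G EN N) where
  r := LieExtension.Equivalent
  iseqv :=
    { refl := fun X => ⟨MonoidHom.id _, fun x => SmoothNear.id x, fun _ => rfl, fun _ => rfl⟩
      symm := fun h => h.symm
      trans := by
        rintro X Y Z ⟨φ, hφ, h1, h2⟩ ⟨ψ, hψ, h3, h4⟩
        exact ⟨ψ.comp φ, fun x => SmoothNear.comp (F := Y.model) (g := ψ) (hψ _) (hφ x),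
          fun n => by simp [h1, h3], fun x => by simp [h2, h4]⟩ }

/-- `Ext(G, N)`: the equivalence classes of Lie group extensions of `G` by `N`. -/
abbrev ExtClasses : Type _ := Quotient (LieExtension.setoid 𝕜 EG G EN N)

variable {G N}

/-- The extension `X` corresponds to the `G`-kernel `[S]`: for a normalized locally smooth section
`σ` of `q`, the outer action `S' = C_N ∘ σ` is equivalent to `S`. -/
def LieExtension.Corresponds (X : LieExtension 𝕜 EG G EN N) (S : G → MulAut N) : Prop :=
  ∃ σ : G → X.carrier, IsC1 𝕜 EG X.model σ ∧ (∀ g, X.q (σ g) = g) ∧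
    ∃ S' : G → MulAut N, (∀ g n, X.ι (S' g n) = σ g * X.ι n * (σ g)⁻¹) ∧ OuterEquiv 𝕜 EG EN S S'

/-- `Ext(G, N)_[S]`. -/
def ExtKernel (S : G → MulAut N) : Set (ExtClasses 𝕜 EG G EN N) :=
  {e | ∃ X : LieExtension 𝕜 EG G EN N, ⟦X⟧ = e ∧ X.Corresponds 𝕜 EG EN S}

variable (G N)

/-- Smooth factor systems for `(G, N)`: the elements `(S, ω)` of `Z²_ss(G, N)`. -/
structure FactorSystem where
  S : G → MulAut N
  ω : G × G → N
  isC1Aut : IsC1Aut 𝕜 EG EN S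
  isC2ss : IsC2ss 𝕜 EG EN ω
  delta_eq : ∀ g g', deltaAut S g g' = MulAut.conj (ω (g, g'))
  d2_eq : ∀ g g' g'', d2 S ω g g' g'' = 1

variable {𝕜 EG EN G N}

/-- The underlying set `N × G` of `N ×_(S,ω) G`; a separate type, since it carries neither the
product group structure nor the product topology. -/
@[ext]
structure TwistedProduct (f : FactorSystem 𝕜 EG G EN N) where
  fst : N
  snd : G

namespace FactorSystem

variable (f : FactorSystem 𝕜 EG G EN N)

theorem mul_apply (g g' : G) (n : N) :
    f.S g (f.S g' n) = f.ω (g, g') * f.S (g * g') n * (f.ω (g, g'))⁻¹ := by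
  have h := f.delta_eq g g'
  rw [deltaAut, mul_inv_eq_iff_eq_mul] at h
  have := DFunLike.congr_fun h n
  simpa [MulAut.mul_apply, MulAut.conj_apply] using this

theorem cocycle (g g' g'' : G) :
    f.S g (f.ω (g', g'')) * f.ω (g, g' * g'') = f.ω (g, g') * f.ω (g * g', g'') := by
  have h := f.d2_eq g g' g''
  rwa [d2, mul_inv_eq_one, mul_inv_eq_iff_eq_mul] at h

end FactorSystem

/-- The multiplication `(n, g)(n', g') = (n S(g)(n') ω(g, g'), gg')`. -/
instance TwistedProduct.group (f : FactorSystem 𝕜 EG G EN N) : Group (TwistedProduct f) :=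
  letI : Mul (TwistedProduct f) := ⟨fun x y => ⟨x.fst * f.S x.snd y.fst * f.ω (x.snd, y.snd),
    x.snd * y.snd⟩⟩
  letI : One (TwistedProduct f) := ⟨⟨1, 1⟩⟩
  letI : Inv (TwistedProduct f) := ⟨fun x => ⟨(f.ω (x.snd⁻¹, x.snd))⁻¹ * f.S x.snd⁻¹ x.fst⁻¹,
    x.snd⁻¹⟩⟩
  Group.ofLeftAxioms
    (by
      intro x y z
      refine TwistedProduct.ext ?_ (mul_assoc _ _ _)
      change x.fst * f.S x.snd y.fst * f.ω (x.snd, y.snd) * f.S (x.snd * y.snd) z.fst *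
        f.ω (x.snd * y.snd, z.snd) = x.fst * f.S x.snd (y.fst * f.S y.snd z.fst *
          f.ω (y.snd, z.snd)) * f.ω (x.snd, y.snd * z.snd)
      simp only [map_mul, f.mul_apply]
      have := f.cocycle x.snd y.snd z.snd
      simp only [mul_assoc, this]
      simp)
    (by
      intro x
      refine TwistedProduct.ext ?_ (one_mul _)
      change 1 * f.S 1 x.fst * f.ω (1, x.snd) = x.fst
      simp [f.isC1Aut.map_one, f.isC2ss.1.2.1])
    (by
      intro x
      refine TwistedProduct.ext ?_ (inv_mul_cancel _)
      change (f.ω (x.snd⁻¹, x.snd))⁻¹ * f.S x.snd⁻¹ x.fst⁻¹ * f.S x.snd⁻¹ x.fst *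
        f.ω (x.snd⁻¹, x.snd) = 1
      simp)

/-- The inclusion `N → N ×_(S,ω) G`, `n ↦ (n, 1)`. -/
def TwistedProduct.inl (f : FactorSystem 𝕜 EG G EN N) : N →* TwistedProduct f where
  toFun n := ⟨n, 1⟩
  map_one' := rfl
  map_mul' n n' := by
    refine TwistedProduct.ext ?_ (one_mul _).symm
    change n * n' = n * f.S 1 n' * f.ω (1, 1)
    simp [f.isC1Aut.map_one, f.isC2ss.1.2.1]

/-- The projection `N ×_(S,ω) G → G`. -/
def TwistedProduct.proj (f : FactorSystem 𝕜 EG G EN N) : TwistedProduct f →* G where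
  toFun x := x.snd
  map_one' := rfl
  map_mul' _ _ := rfl

/-- A Lie group structure on the group `N ×_(S,ω) G` for which `N × G → N ×_(S,ω) G`,
`(n, g) ↦ (n, g)`, is smooth on `N × U` for an open identity neighbourhood `U ⊆ G`, and for which
`N → N ×_(S,ω) G → G` is an extension of Lie groups. -/
structure TwistedLieStructure (f : FactorSystem 𝕜 EG G EN N) where
  model : Type (max u v)
  [addCommGroup : AddCommGroup model]
  [module : Module 𝕜 model]
  [topologicalSpaceModel : TopologicalSpace model]
  [isTopologicalAddGroup : IsTopologicalAddGroup model]
  [continuousSMul : ContinuousSMul 𝕜 model]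
  [polynormableSpace : PolynormableSpace 𝕜 model]
  [t2Space : T2Space model]
  [topologicalSpace : TopologicalSpace (TwistedProduct f)]
  [chartedSpace : ChartedSpace model (TwistedProduct f)]
  [lieGroup : LocConvLieGroup 𝕜 model (TwistedProduct f)]
  isLieExtension : IsLieExtension 𝕜 EG EN model (TwistedProduct.inl f) (TwistedProduct.proj f)
  smooth_mk : ∃ U : Set G, IsOpen U ∧ 1 ∈ U ∧
    SmoothOnSet 𝕜 (EN × EG) model (fun p : N × G => (⟨p.1, p.2⟩ : TwistedProduct f)) (univ ×ˢ U)

attribute [instance] TwistedLieStructure.addCommGroup TwistedLieStructure.module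
  TwistedLieStructure.topologicalSpaceModel TwistedLieStructure.isTopologicalAddGroup
  TwistedLieStructure.continuousSMul TwistedLieStructure.polynormableSpace
  TwistedLieStructure.t2Space

/-- The extension `N ×_(S,ω) G`, with a given Lie group structure as above. -/
def TwistedLieStructure.toLieExtension {f : FactorSystem 𝕜 EG G EN N}
    (L : TwistedLieStructure f) : LieExtension 𝕜 EG G EN N :=
  letI := L.topologicalSpace
  letI := L.chartedSpace
  letI := L.lieGroup
  { carrier := TwistedProduct f
    model := L.model
    ι := TwistedProduct.inl f
    q := TwistedProduct.proj f
    isLieExtension := L.isLieExtension }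

/-- `e` is the equivalence class `[N ×_(S,ω) G]`. -/
def IsTwistedClass (f : FactorSystem 𝕜 EG G EN N) (e : ExtClasses 𝕜 EG G EN N) : Prop :=
  ∃ L : TwistedLieStructure f, ⟦L.toLieExtension⟧ = e

/-- Equivalent outer actions agree on the centre. -/
theorem OuterEquiv.eq_on_center {S S' : G → MulAut N} (h : OuterEquiv 𝕜 EG EN S S') (g : G) {z : N}
    (hz : z ∈ Subgroup.center N) : S' g z = S g z := by
  obtain ⟨h, -, hh⟩ := h
  have := Subgroup.mem_center_iff.1 (map_center (S g) hz) (h g)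
  rw [hh, MulAut.mul_apply, MulAut.conj_apply, this, mul_inv_cancel_right]

theorem central_rearrange (p q r s a b c d : N) (ha : ∀ n, n * a = a * n)
    (hb : ∀ n, n * b = b * n) (hc : ∀ n, n * c⁻¹ = c⁻¹ * n) (hd : ∀ n, n * d⁻¹ = d⁻¹ * n) :
    p * a * (q * b) * (r * c)⁻¹ * (s * d)⁻¹ = p * q * r⁻¹ * s⁻¹ * (a * b * c⁻¹ * d⁻¹) := by
  have e1 : p * a * (q * b) = p * q * (a * b) := by
    rw [mul_assoc, ← mul_assoc a, ← ha q]; simp only [mul_assoc]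
  have e2 : ∀ n : N, (a * b * c⁻¹) * n = n * (a * b * c⁻¹) := fun n => by
    rw [mul_assoc, ← hc, ← mul_assoc, mul_assoc a, ← hb, ← mul_assoc, ← ha]
    simp only [mul_assoc]
  rw [e1, mul_inv_rev, mul_inv_rev, ← hd]
  calc p * q * (a * b) * (c⁻¹ * r⁻¹) * (s⁻¹ * d⁻¹)
      = p * q * ((a * b * c⁻¹) * (r⁻¹ * s⁻¹)) * d⁻¹ := by simp only [mul_assoc]
    _ = p * q * r⁻¹ * s⁻¹ * (a * b * c⁻¹ * d⁻¹) := by rw [e2]; simp only [mul_assoc]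

/-- For a smooth factor system `(S', ω)` with `S' ∼ S` and `β ∈ Z²_ss(G, Z(N))_[S]`, the smooth
factor system `(S', ω · β)`. -/
def FactorSystem.twist {S : G → MulAut N} (f : FactorSystem 𝕜 EG G EN N)
    (hf : OuterEquiv 𝕜 EG EN S f.S) (β : Z2ss 𝕜 EG EN S) : FactorSystem 𝕜 EG G EN N where
  S := f.S
  ω := fun p => f.ω p * (β.1 p : N)
  isC1Aut := f.isC1Aut
  isC2ss := f.isC2ss.mul_central β.2.1 fun p => (β.1 p).2
  delta_eq g g' := by
    have : MulAut.conj (β.1 (g, g') : N) = 1 := by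
      ext n
      rw [MulAut.conj_apply, ← Subgroup.mem_center_iff.1 (β.1 (g, g')).2 n]
      simp
    rw [f.delta_eq, map_mul, this, mul_one]
  d2_eq g g' g'' := by
    have h1 := β.2.2 g g' g''
    have h2 := f.d2_eq g g' g''
    unfold d2 at *
    simp only [map_mul, hf.eq_on_center g (β.1 (g', g'')).2]
    have c1 := Subgroup.mem_center_iff.1 (map_center (S g) (β.1 (g', g'')).2)
    have c2 := Subgroup.mem_center_iff.1 (β.1 (g, g' * g'')).2
    have c3 := Subgroup.mem_center_iff.1 (inv_mem (β.1 (g * g', g'')).2)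
    have c4 := Subgroup.mem_center_iff.1 (inv_mem (β.1 (g, g')).2)
    set a := S g (β.1 (g', g'') : N)
    set b : N := (β.1 (g, g' * g'') : N)
    set c : N := (β.1 (g * g', g'') : N)
    set d : N := (β.1 (g, g') : N)
    calc _ = (f.S g (f.ω (g', g'')) * f.ω (g, g' * g'') * (f.ω (g * g', g''))⁻¹ *
          (f.ω (g, g'))⁻¹) * (a * b * c⁻¹ * d⁻¹) := by
          exact central_rearrange _ _ _ _ _ _ _ _ c1 c2 c3 c4
      _ = 1 := by rw [h1, h2, mul_one]

end Equivalence

end Extensions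

end NonabelianExt

open NonabelianExt

/-!
Extensions of `G` by `N` and smooth factor systems are matched by sections: a normalized locally
smooth section `ρ` of an extension `X` induces a factor system `(S, ω)`, and then
`(n, g) ↦ ι(n) ρ(g)` is an equivalence of `N ×_(S,ω) G` with `X`. In particular `N ×_(S,ω) G` and
`N ×_(S',ω') G` are equivalent if and only if some section `g ↦ (h(g), g)` of the latter induces
`(S, ω)`. When `S = S'`, this forces `h` to be central and `ω = ω' · d_S h`. Since `S` determines
`C_N(ω(g, g'))`, the factor systems over a fixed `S` form a torsor under `Z²_ss`; hence their
equivalence classes, which are all of `Ext(G, N)_[S]`, form a torsor under `H²_ss`.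

The Lie group structure on `N ×_(S,ω) G` is obtained by declaring `(n, g) ↦ (n, g)` to be a chart
over a small identity neighbourhood `N × U`, and by right translating this chart: right translations
are smooth by the cocycle identity, and the condition `ω ∈ C²_ss` is what makes conjugations, and
with them the multiplication, smooth.
-/

namespace NonabelianExt

section Locality

variable {𝕜 : Type*} [RCLike 𝕜]

theorem HasDirDeriv.unique {X Y : Type*} [AddCommGroup X] [Module 𝕜 X]
    [AddCommGroup Y] [Module 𝕜 Y] [TopologicalSpace Y] [T2Space Y] {f : X → Y} {x h : X} {y z : Y}
    (hy : HasDirDeriv 𝕜 f x h y) (hz : HasDirDeriv 𝕜 f x h z) : y = z :=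
  tendsto_nhds_unique hy hz

-- Uniqueness of directional derivatives lets the local derivatives be glued to one `df`.
theorem CnOn.of_locally {n : ℕ} : ∀ {X : Type*} {Y : Type*} [AddCommGroup X] [Module 𝕜 X]
    [TopologicalSpace X] [IsTopologicalAddGroup X] [ContinuousSMul 𝕜 X]
    [AddCommGroup Y] [Module 𝕜 Y] [TopologicalSpace Y] [T2Space Y] {f : X → Y} {U : Set X},
    IsOpen U → (∀ x ∈ U, ∃ O, IsOpen O ∧ x ∈ O ∧ CnOn 𝕜 n f O) → CnOn 𝕜 n f U := by
  induction n with
  | zero =>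
    intro X Y _ _ _ _ _ _ _ _ _ f U _ hf x hx
    obtain ⟨O, hO, hxO, hfO⟩ := hf x hx
    exact (hfO.continuousOn.continuousAt (hO.mem_nhds hxO)).continuousWithinAt
  | succ n ih =>
    intro X Y _ _ _ _ _ _ _ _ _ f U hU hf
    choose! O hO hxO hfO df hdf hdfO using hf
    have continuousOn : ContinuousOn f U := fun x hx =>
      ((hfO x hx).continuousAt ((hO x hx).mem_nhds (hxO x hx))).continuousWithinAt
    refine ⟨continuousOn, fun p => df p.1 p, fun x hx v => hdf x hx x (hxO x hx) v,
      ih (hU.prod isOpen_univ) fun p hp => ?_⟩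
    have hW : IsOpen ((O p.1 ∩ U) ×ˢ (univ : Set X)) := ((hO _ hp.1).inter hU).prod isOpen_univ
    refine ⟨_, hW, ⟨⟨hxO _ hp.1, hp.1⟩, trivial⟩, ((hdfO _ hp.1).mono
      (prod_mono inter_subset_left subset_rfl)).congr hW fun y hy => ?_⟩
    exact (hdf y.1 hy.1.2 y.1 (hxO _ hy.1.2) y.2).unique (hdf p.1 hp.1 y.1 hy.1.1 y.2)

end Locality

section SmoothNear

variable {𝕜 : Type*} [RCLike 𝕜]
  {E F H : Type*} [AddCommGroup E] [Module 𝕜 E] [TopologicalSpace E]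
  [IsTopologicalAddGroup E] [ContinuousSMul 𝕜 E]
  [AddCommGroup F] [Module 𝕜 F] [TopologicalSpace F]
  [IsTopologicalAddGroup F] [ContinuousSMul 𝕜 F]
  {M M' M'' : Type*} [TopologicalSpace M] [ChartedSpace E M] [TopologicalSpace M']
  [ChartedSpace F M'] [SmoothManifold 𝕜 F M']

theorem SmoothNear.comp_of_eq [AddCommGroup H] [Module 𝕜 H] [TopologicalSpace H]
    [IsTopologicalAddGroup H] [ContinuousSMul 𝕜 H] [PolynormableSpace 𝕜 H]
    [TopologicalSpace M''] [ChartedSpace H M''] {g : M' → M''} {f : M → M'} {x : M} {y : M'}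
    (hg : SmoothNear 𝕜 F H g y) (hf : SmoothNear 𝕜 E F f x) (hy : f x = y) :
    SmoothNear 𝕜 E H (fun z => g (f z)) x := by
  subst hy
  exact hg.comp hf

theorem SmoothNear.exists_charts [PolynormableSpace 𝕜 F] [SmoothManifold 𝕜 E M] {f : M → M'}
    {x : M} (hf : SmoothNear 𝕜 E F f x) {e : OpenPartialHomeomorph M E} (he : e ∈ atlas E M)
    (hx : x ∈ e.source) {e' : OpenPartialHomeomorph M' F} (he' : e' ∈ atlas F M')
    (hx' : f x ∈ e'.source) :
    ∃ O : Set E, IsOpen O ∧ O ⊆ e.target ∧ e x ∈ O ∧ MapsTo (f ∘ e.symm) O e'.source ∧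
      SmoothOnOpen 𝕜 (e' ∘ f ∘ e.symm) O := by
  obtain ⟨d, hd, O, hO, hOt, hxO, hm, hs⟩ := hf.exists_chart he hx
  have transition := SmoothManifold.compatible (𝕜 := 𝕜) d hd e' he'
  have isOpen_transition : IsOpen (d.target ∩ d.symm ⁻¹' e'.source) :=
    d.isOpen_inter_preimage_symm e'.open_source
  have left_inv : ∀ u ∈ O, d.symm (d (f (e.symm u))) = f (e.symm u) :=
    fun u hu => d.left_inv (hm hu)
  have isOpen_inter := (hs 0).continuousOn.isOpen_inter_preimage hO isOpen_transition
  refine ⟨_, isOpen_inter, inter_subset_left.trans hOt, ⟨hxO, d.map_source (hm hxO), ?_⟩,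
    fun u hu => ?_, fun n => ?_⟩
  · have h := left_inv _ hxO
    rw [e.left_inv hx] at h
    simpa [h, hx] using hx'
  · simpa [left_inv u hu.1] using hu.2.2
  · refine ((transition n).comp isOpen_transition ((hs n).mono inter_subset_left)
      fun u hu => hu.2).congr isOpen_inter fun u hu => ?_
    simp [left_inv u hu.1]

end SmoothNear

section Gluing

/-- Patches identifying subsets of a bare set `T` with subsets of a manifold `M`, covering `T` and
with smooth transition maps between open sets: the data that glue to a manifold structure on `T`. -/
structure SmoothPatching (𝕜 : Type*) [RCLike 𝕜] (E : Type*) [AddCommGroup E] [Module 𝕜 E]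
    [TopologicalSpace E] (M : Type*) [TopologicalSpace M] [ChartedSpace E M] (I T : Type*) where
  patch : I → PartialEquiv T M
  indexAt : T → I
  mem_source_indexAt : ∀ x, x ∈ (patch (indexAt x)).source
  isOpen_transition_source : ∀ i j, IsOpen ((patch i).symm.trans (patch j)).source
  smooth_transition : ∀ i j, SmoothOnSet 𝕜 E E ((patch i).symm.trans (patch j))
    ((patch i).symm.trans (patch j)).source

namespace SmoothPatching

variable {𝕜 : Type*} [RCLike 𝕜] {E : Type*} [AddCommGroup E] [Module 𝕜 E] [TopologicalSpace E]
  {M : Type*} [TopologicalSpace M] [ChartedSpace E M] {I T : Type*}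
  (A : SmoothPatching 𝕜 E M I T)

/-- The change of coordinates from the patch `i` to the patch `j`. -/
def transition (i j : I) : PartialEquiv M M := (A.patch i).symm.trans (A.patch j)

theorem continuousOn_transition (i j : I) :
    ContinuousOn (A.transition i j) (A.transition i j).source :=
  fun p hp => (A.smooth_transition i j p hp).continuousAt.continuousWithinAt

theorem isOpen_transition_inter_preimage (i j : I) {s : Set M} (hs : IsOpen s) :
    IsOpen ((A.transition i j).source ∩ A.transition i j ⁻¹' s) :=
  (A.continuousOn_transition i j).isOpen_inter_preimage (A.isOpen_transition_source i j) hs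

/-- The chart of `T` obtained from the patch `i` and a chart `e` of `M`. -/
def coord (i : I) (e : OpenPartialHomeomorph M E) : PartialEquiv T E :=
  (A.patch i).trans e.toPartialEquiv

theorem coord_symm_trans_source (i j : I) (e e' : OpenPartialHomeomorph M E) :
    ((A.coord i e).symm.trans (A.coord j e')).source = e.target ∩ e.symm ⁻¹'
      ((A.transition i j).source ∩ A.transition i j ⁻¹' e'.source) := by
  ext u
  simp only [coord, transition, PartialEquiv.trans_source, PartialEquiv.symm_source,
    PartialEquiv.trans_symm_eq_symm_trans_symm, mem_inter_iff, mem_preimage,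
    PartialEquiv.coe_trans, Function.comp_apply]
  tauto

/-- The charts of `T` obtained from the patches and the charts of `M`; they define its topology. -/
def chartedSpaceCore : ChartedSpaceCore E T where
  atlas := {c | ∃ i, ∃ e ∈ atlas E M, c = A.coord i e}
  chartAt x := A.coord (A.indexAt x) (chartAt E (A.patch (A.indexAt x) x))
  mem_chart_source x := ⟨A.mem_source_indexAt x, mem_chart_source E _⟩
  chart_mem_atlas x := ⟨A.indexAt x, _, chart_mem_atlas E _, rfl⟩
  open_source := by
    rintro _ _ ⟨i, e, -, rfl⟩ ⟨j, e', -, rfl⟩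
    rw [coord_symm_trans_source]
    exact e.isOpen_inter_preimage_symm (A.isOpen_transition_inter_preimage i j e'.open_source)
  continuousOn_toFun := by
    rintro _ _ ⟨i, e, -, rfl⟩ ⟨j, e', -, rfl⟩
    rw [coord_symm_trans_source]
    exact e'.continuousOn.comp ((A.continuousOn_transition i j).comp
      (e.continuousOn_symm.mono inter_subset_left) fun u hu => hu.2.1) fun u hu => hu.2.2

/-- The topology of the manifold glued from the patches. -/
abbrev topologicalSpace : TopologicalSpace T := A.chartedSpaceCore.toTopologicalSpace

/-- The atlas of the manifold glued from the patches. -/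
abbrev chartedSpace : letI := A.topologicalSpace; ChartedSpace E T :=
  A.chartedSpaceCore.toChartedSpace

/-- `coord i e`, as a homeomorphism for the glued topology. -/
def chart (i : I) {e : OpenPartialHomeomorph M E} (he : e ∈ atlas E M) :
    letI := A.topologicalSpace; OpenPartialHomeomorph T E :=
  A.chartedSpaceCore.openPartialHomeomorph (A.coord i e) ⟨i, e, he, rfl⟩

theorem chart_mem_atlas (i : I) {e : OpenPartialHomeomorph M E} (he : e ∈ atlas E M) :
    letI := A.topologicalSpace
    letI := A.chartedSpace
    A.chart i he ∈ atlas E T :=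
  mem_iUnion₂.2 ⟨A.coord i e, ⟨i, e, he, rfl⟩, rfl⟩

theorem exists_eq_chart_of_mem_atlas :
    letI := A.topologicalSpace
    letI := A.chartedSpace
    ∀ d ∈ atlas E T, ∃ i, ∃ e, ∃ he : e ∈ atlas E M, d = A.chart i he := by
  intro d hd
  obtain ⟨_, ⟨i, e, he, rfl⟩, hd⟩ := mem_iUnion₂.1 hd
  exact ⟨i, e, he, hd⟩

theorem isOpen_source (i : I) :
    letI := A.topologicalSpace
    IsOpen (A.patch i).source := by
  let := A.topologicalSpace
  refine isOpen_iff_mem_nhds.2 fun x hx => ?_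
  have he : chartAt E (A.patch i x) ∈ atlas E M := _root_.chart_mem_atlas E _
  exact mem_of_superset ((A.chart i he).open_source.mem_nhds ⟨hx, mem_chart_source E _⟩)
    fun z hz => hz.1

variable [IsTopologicalAddGroup E] [ContinuousSMul 𝕜 E]

theorem smoothManifold [PolynormableSpace 𝕜 E] [T2Space E] [SmoothManifold 𝕜 E M] :
    letI := A.topologicalSpace
    letI := A.chartedSpace
    SmoothManifold 𝕜 E T := by
  let := A.topologicalSpace
  let := A.chartedSpace
  refine ⟨fun d hd d' hd' n => ?_⟩
  obtain ⟨i, e, he, rfl⟩ := A.exists_eq_chart_of_mem_atlas d hd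
  obtain ⟨j, e', he', rfl⟩ := A.exists_eq_chart_of_mem_atlas d' hd'
  change CnOn 𝕜 n (e' ∘ A.transition i j ∘ e.symm)
    ((A.coord i e).symm.trans (A.coord j e')).source
  rw [coord_symm_trans_source]
  refine CnOn.of_locally (e.isOpen_inter_preimage_symm
    (A.isOpen_transition_inter_preimage i j e'.open_source)) fun u ⟨hu, hut, hue'⟩ => ?_
  obtain ⟨O, hO, -, huO, -, hs⟩ :=
    (A.smooth_transition i j _ hut).exists_charts he (e.map_target hu) he' hue'
  exact ⟨O, hO, by rwa [e.right_inv hu] at huO, hs n⟩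

theorem smoothOnSet_patch (i : I) :
    letI := A.topologicalSpace
    letI := A.chartedSpace
    SmoothOnSet 𝕜 E E (A.patch i) (A.patch i).source := by
  let := A.topologicalSpace
  let := A.chartedSpace
  intro x hx
  set e := chartAt E (A.patch i x)
  have he : e ∈ atlas E M := _root_.chart_mem_atlas E _
  have hxd : x ∈ (A.chart i he).source := ⟨hx, mem_chart_source E _⟩
  have patch_symm : ∀ u ∈ (A.chart i he).target, A.patch i ((A.chart i he).symm u) = e.symm u :=
    fun u hu => (A.patch i).right_inv hu.2
  refine ⟨A.chart i he, A.chart_mem_atlas i he, e, he, hxd, _, (A.chart i he).open_target,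
    subset_rfl, (A.chart i he).map_source hxd, fun u hu => ?_, fun n => ?_⟩
  · rw [Function.comp_apply, patch_symm u hu]
    exact e.map_target hu.1
  · refine (cnOn_clm (ContinuousLinearMap.id 𝕜 E) _).congr (A.chart i he).open_target
      fun u hu => ?_
    rw [Function.comp_apply, Function.comp_apply, patch_symm u hu]
    exact e.right_inv hu.1

theorem smoothOnSet_patch_symm (i : I) :
    letI := A.topologicalSpace
    letI := A.chartedSpace
    SmoothOnSet 𝕜 E E (A.patch i).symm (A.patch i).target := by
  let := A.topologicalSpace
  let := A.chartedSpace
  intro p hp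
  set e := chartAt E p
  have he : e ∈ atlas E M := _root_.chart_mem_atlas E p
  have hpd : e p ∈ (A.chart i he).target := by
    refine ⟨mem_chart_target E p, ?_⟩
    change e.symm (e p) ∈ (A.patch i).target
    rwa [e.left_inv (mem_chart_source E p)]
  refine ⟨e, he, A.chart i he, A.chart_mem_atlas i he, mem_chart_source E p, _,
    (A.chart i he).open_target, fun u hu => hu.1, hpd,
    fun u hu => (A.chart i he).map_target hu, fun n => ?_⟩
  exact (cnOn_clm (ContinuousLinearMap.id 𝕜 E) _).congr (A.chart i he).open_target
    fun u hu => (A.chart i he).right_inv hu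

end SmoothPatching

end Gluing

section LocalCriteria

variable {𝕜 : Type*} [RCLike 𝕜]
  {E : Type*} [AddCommGroup E] [Module 𝕜 E] [TopologicalSpace E] [IsTopologicalAddGroup E]
  [ContinuousSMul 𝕜 E] [PolynormableSpace 𝕜 E]

theorem LocConvLieGroup.of_smoothNear_one {T : Type*} [Group T] [TopologicalSpace T]
    [ChartedSpace E T] [SmoothManifold 𝕜 E T]
    (mul_right : ∀ y, SmoothMap 𝕜 E E (fun x : T => x * y))
    (mul_one : SmoothNear 𝕜 (E × E) E (fun p : T × T => p.1 * p.2) (1, 1))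
    (inv_one : SmoothNear 𝕜 E E (fun x : T => x⁻¹) 1)
    (conj_one : ∀ y, SmoothNear 𝕜 E E (fun x : T => y * x * y⁻¹) 1) : LocConvLieGroup 𝕜 E T where
  smooth_mul := by
    rintro ⟨x, y⟩
    have fst : SmoothNear 𝕜 (E × E) E (fun p : T × T => p.1 * x⁻¹) (x, y) :=
      (mul_right x⁻¹ x).comp_of_eq (SmoothNear.fst _) rfl
    have snd : SmoothNear 𝕜 (E × E) E (fun p : T × T => p.2 * y⁻¹) (x, y) :=
      (mul_right y⁻¹ y).comp_of_eq (SmoothNear.snd _) rfl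
    have conj_snd : SmoothNear 𝕜 (E × E) E (fun p : T × T => x * (p.2 * y⁻¹) * x⁻¹) (x, y) :=
      (conj_one x).comp_of_eq snd (mul_inv_cancel y)
    have mul : SmoothNear 𝕜 (E × E) E
        (fun p : T × T => (p.1 * x⁻¹) * (x * (p.2 * y⁻¹) * x⁻¹)) (x, y) :=
      mul_one.comp_of_eq (fst.prodMk conj_snd) (by simp)
    simpa [mul_assoc] using (mul_right (x * y) _).comp mul
  smooth_inv x := by
    have inv : SmoothNear 𝕜 E E (fun z : T => (z * x⁻¹)⁻¹) x :=
      inv_one.comp_of_eq (mul_right x⁻¹ x) (mul_inv_cancel x)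
    have conj_inv : SmoothNear 𝕜 E E (fun z : T => x⁻¹ * (z * x⁻¹)⁻¹ * (x⁻¹)⁻¹) x :=
      (conj_one x⁻¹).comp_of_eq inv (by simp)
    simpa [mul_assoc] using (mul_right x⁻¹ _).comp conj_inv

theorem smoothMap_of_smoothNear_one {F : Type*} [AddCommGroup F] [Module 𝕜 F] [TopologicalSpace F]
    [IsTopologicalAddGroup F] [ContinuousSMul 𝕜 F] [PolynormableSpace 𝕜 F]
    {A B : Type*} [Group A] [TopologicalSpace A] [ChartedSpace E A] [LocConvLieGroup 𝕜 E A]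
    [Group B] [TopologicalSpace B] [ChartedSpace F B] [LocConvLieGroup 𝕜 F B] (φ : A →* B)
    (h : SmoothNear 𝕜 E F φ 1) : SmoothMap 𝕜 E F φ := by
  intro a
  have translate : SmoothNear 𝕜 E E (fun x : A => a⁻¹ * x) a :=
    (SmoothNear.const _ _).mul (SmoothNear.id a)
  have map_translate : SmoothNear 𝕜 E F (fun x : A => φ (a⁻¹ * x)) a :=
    h.comp_of_eq translate (inv_mul_cancel a)
  simpa using (SmoothNear.const (φ a) a).mul map_translate

end LocalCriteria

section TranslationPatch

/-- A subset of a group `T` containing `1` and identified with a subset of a manifold `M`, in which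
all right translations are smooth wherever they are defined. Its right translates glue to a manifold
structure on `T`. -/
structure TranslationPatch (𝕜 : Type*) [RCLike 𝕜] (E : Type*) [AddCommGroup E] [Module 𝕜 E]
    [TopologicalSpace E] (M : Type*) [TopologicalSpace M] [ChartedSpace E M] (T : Type*)
    [Group T] where
  patch : PartialEquiv T M
  one_mem_source : 1 ∈ patch.source
  isOpen_translation_source : ∀ t, IsOpen {p ∈ patch.target | patch.symm p * t ∈ patch.source}
  smooth_translation : ∀ t, SmoothOnSet 𝕜 E E (fun p => patch (patch.symm p * t))
    {p ∈ patch.target | patch.symm p * t ∈ patch.source}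

namespace TranslationPatch

variable {𝕜 : Type*} [RCLike 𝕜] {E : Type*} [AddCommGroup E] [Module 𝕜 E] [TopologicalSpace E]
  {M : Type*} [TopologicalSpace M] [ChartedSpace E M] {T : Type*} [Group T]
  (A : TranslationPatch 𝕜 E M T)

/-- The right translates `x ↦ patch (x * t⁻¹)` of the given patch, indexed by `t`. -/
def smoothPatching : SmoothPatching 𝕜 E M T T where
  patch t := (Equiv.mulRight t).symm.toPartialEquiv.trans A.patch
  indexAt := id
  mem_source_indexAt x := by simpa using A.one_mem_source
  isOpen_transition_source s t := by
    convert A.isOpen_translation_source (s * t⁻¹) using 1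
    ext p
    simp [PartialEquiv.trans_source, mul_assoc]
  smooth_transition s t := by
    convert A.smooth_translation (s * t⁻¹) using 1
    · funext p
      simp [mul_assoc]
    · ext p
      simp [PartialEquiv.trans_source, mul_assoc]

/-- The topology on `T` glued from the right translates of the patch. -/
abbrev topologicalSpace : TopologicalSpace T := A.smoothPatching.topologicalSpace

/-- The atlas on `T` glued from the right translates of the patch. -/
abbrev chartedSpace : letI := A.topologicalSpace; ChartedSpace E T :=
  A.smoothPatching.chartedSpace

variable [IsTopologicalAddGroup E] [ContinuousSMul 𝕜 E]

theorem smoothOnSet_patch :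
    letI := A.topologicalSpace
    letI := A.chartedSpace
    SmoothOnSet 𝕜 E E A.patch A.patch.source := by
  simpa [smoothPatching, Function.comp_def, SmoothOnSet] using A.smoothPatching.smoothOnSet_patch 1

theorem smoothOnSet_patch_symm :
    letI := A.topologicalSpace
    letI := A.chartedSpace
    SmoothOnSet 𝕜 E E A.patch.symm A.patch.target := by
  have patch_one_symm : (A.smoothPatching.patch 1).symm = (A.patch.symm : M → T) :=
    funext fun p => mul_one _
  have target : (A.smoothPatching.patch 1).target = A.patch.target := by simp [smoothPatching]
  exact patch_one_symm ▸ target ▸ A.smoothPatching.smoothOnSet_patch_symm 1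

variable [PolynormableSpace 𝕜 E] [T2Space E] [SmoothManifold 𝕜 E M]

theorem smoothManifold :
    letI := A.topologicalSpace
    letI := A.chartedSpace
    SmoothManifold 𝕜 E T :=
  A.smoothPatching.smoothManifold

theorem smoothMap_mul_right (y : T) :
    letI := A.topologicalSpace
    letI := A.chartedSpace
    SmoothMap 𝕜 E E (fun x : T => x * y) := by
  let := A.topologicalSpace
  let := A.chartedSpace
  have := A.smoothManifold
  intro x
  have patch_x := A.smoothPatching.smoothOnSet_patch x x (A.smoothPatching.mem_source_indexAt x)
  have symm_patch_xy := A.smoothPatching.smoothOnSet_patch_symm (x * y)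
    (A.smoothPatching.patch x x) (by
      simpa [smoothPatching] using A.patch.map_source A.one_mem_source)
  -- Right translation by `y` is the identity between the patches around `x` and `x * y`.
  refine (symm_patch_xy.comp patch_x).congr ?_
  filter_upwards [(A.smoothPatching.isOpen_source x).mem_nhds
    (A.smoothPatching.mem_source_indexAt x)] with z hz
  have hz : z * x⁻¹ ∈ A.patch.source := by simpa [smoothPatching] using hz
  change A.patch.symm (A.patch (z * x⁻¹)) * (x * y) = z * y
  rw [A.patch.left_inv hz]
  group

end TranslationPatch

end TranslationPatch

section IsLieExtension

namespace IsLieExtension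

variable {𝕜 : Type*} [RCLike 𝕜]
  {EG : Type*} [AddCommGroup EG] [Module 𝕜 EG] [TopologicalSpace EG]
  {G : Type*} [Group G] [TopologicalSpace G] [ChartedSpace EG G]
  {EN : Type*} [AddCommGroup EN] [Module 𝕜 EN] [TopologicalSpace EN]
  {N : Type*} [Group N] [TopologicalSpace N] [ChartedSpace EN N]
  {EX : Type*} [AddCommGroup EX] [Module 𝕜 EX] [TopologicalSpace EX]
  {X : Type*} [Group X] [TopologicalSpace X] [ChartedSpace EX X] {ι : N →* X} {q : X →* G}

theorem q_ι (h : IsLieExtension 𝕜 EG EN EX ι q) (n : N) : q (ι n) = 1 :=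
  MonoidHom.mem_ker.1 (h.exact ▸ ⟨n, rfl⟩)

theorem exists_ι_eq (h : IsLieExtension 𝕜 EG EN EX ι q) {x : X} (hx : q x = 1) : ∃ n, ι n = x :=
  MonoidHom.mem_range.1 (h.exact ▸ MonoidHom.mem_ker.2 hx)

variable [IsTopologicalAddGroup EN] [ContinuousSMul 𝕜 EN] [PolynormableSpace 𝕜 EN]
  [LocConvLieGroup 𝕜 EN N] [IsTopologicalAddGroup EX] [ContinuousSMul 𝕜 EX]

theorem exists_retraction [SmoothManifold 𝕜 EX X] (h : IsLieExtension 𝕜 EG EN EX ι q) :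
    ∃ r : X → N, (∀ n, r (ι n) = n) ∧ ∀ n, SmoothNear 𝕜 EX EN r (ι n) := by
  obtain ⟨U, -, one_mem, σ, -, -, τ, hτ, eq_mul⟩ := h.principal 1
  have ι_mem (n : N) : ι n ∈ q ⁻¹' U := by simpa [h.q_ι] using one_mem
  have ι_eq (n : N) : ι n = σ 1 * ι (τ (ι n)) := by
    simpa [h.q_ι] using eq_mul (ι n) (ι_mem n)
  refine ⟨fun x => (τ 1)⁻¹ * τ x, fun n => h.injective ?_,
    fun n => (SmoothNear.const _ _).mul (hτ _ (ι_mem n))⟩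
  have one_eq := ι_eq 1
  rw [map_one, eq_comm, mul_eq_one_iff_eq_inv] at one_eq
  rw [map_mul, map_inv, ← one_eq, ← ι_eq]

/-- `N` is an initial submanifold of the total group of an extension. -/
theorem smoothNear_of_ι [SmoothManifold 𝕜 EX X] (h : IsLieExtension 𝕜 EG EN EX ι q)
    {E : Type*} [AddCommGroup E] [Module 𝕜 E] [TopologicalSpace E] [IsTopologicalAddGroup E]
    [ContinuousSMul 𝕜 E] {M : Type*} [TopologicalSpace M] [ChartedSpace E M]
    {f : M → N} {x : M} (hf : SmoothNear 𝕜 E EX (fun y => ι (f y)) x) :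
    SmoothNear 𝕜 E EN f x := by
  obtain ⟨r, r_ι, hr⟩ := h.exists_retraction
  simpa only [r_ι] using (hr (f x)).comp_of_eq hf rfl

-- Left translations carry the local trivialization around `1` to any other point of `G`.
theorem of_principal_one [IsTopologicalAddGroup EG] [ContinuousSMul 𝕜 EG] [PolynormableSpace 𝕜 EG]
    [LocConvLieGroup 𝕜 EG G] [PolynormableSpace 𝕜 EX] [LocConvLieGroup 𝕜 EX X]
    (smooth_ι : SmoothNear 𝕜 EN EX ι 1) (smooth_q : SmoothNear 𝕜 EX EG q 1)
    (injective : Function.Injective ι) (exact : ι.range = q.ker)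
    (surjective : Function.Surjective q) {U : Set G} (hU : IsOpen U) (one_mem : 1 ∈ U)
    {σ : G → X} (hσ : SmoothOnSet 𝕜 EG EX σ U) (q_σ : ∀ y ∈ U, q (σ y) = y)
    {τ : X → N} (hτ : SmoothOnSet 𝕜 EX EN τ (q ⁻¹' U))
    (eq_mul : ∀ x ∈ q ⁻¹' U, x = σ (q x) * ι (τ x)) : IsLieExtension 𝕜 EG EN EX ι q where
  smooth_ι := smoothMap_of_smoothNear_one ι smooth_ι
  smooth_q := smoothMap_of_smoothNear_one q smooth_q
  injective := injective
  exact := exact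
  surjective := surjective
  principal g := by
    obtain ⟨x, rfl⟩ := surjective g
    have translate_G (y : G) : SmoothNear 𝕜 EG EG (fun y => (q x)⁻¹ * y) y :=
      (SmoothNear.const _ _).mul (SmoothNear.id y)
    have translate_X (y : X) : SmoothNear 𝕜 EX EX (fun y => x⁻¹ * y) y :=
      (SmoothNear.const _ _).mul (SmoothNear.id y)
    have q_translate (y : X) : q (x⁻¹ * y) = (q x)⁻¹ * q y := by simp
    refine ⟨(fun y => (q x)⁻¹ * y) ⁻¹' U, hU.preimage (continuous_iff_continuousAt.2 fun y =>
      (translate_G y).continuousAt), by simpa using one_mem, fun y => x * σ ((q x)⁻¹ * y),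
      fun y hy => (SmoothNear.const _ _).mul ((hσ _ hy).comp (translate_G y)),
      fun y hy => by simp [q_σ _ hy], fun y => τ (x⁻¹ * y), fun y hy => ?_, fun y hy => ?_⟩
    · exact (hτ _ (by simpa using hy)).comp (translate_X y)
    · have eq := eq_mul (x⁻¹ * y) (by simpa using hy)
      rwa [q_translate, inv_mul_eq_iff_eq_mul, ← mul_assoc] at eq

end IsLieExtension

end IsLieExtension

section FactorSystem

variable {𝕜 : Type w} [RCLike 𝕜]
  {EG : Type u} [AddCommGroup EG] [Module 𝕜 EG] [TopologicalSpace EG]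
  {G : Type u} [Group G] [TopologicalSpace G] [ChartedSpace EG G]
  {EN : Type v} [AddCommGroup EN] [Module 𝕜 EN] [TopologicalSpace EN]
  {N : Type v} [Group N] [TopologicalSpace N] [ChartedSpace EN N]

namespace FactorSystem

variable (f : FactorSystem 𝕜 EG G EN N)

@[simp] theorem ω_one_left (g : G) : f.ω (1, g) = 1 := f.isC2ss.1.2.1 g

@[simp] theorem ω_one_right (g : G) : f.ω (g, 1) = 1 := f.isC2ss.1.1 g

@[simp] theorem S_one : f.S 1 = 1 := f.isC1Aut.map_one

/-- A symmetric open identity neighbourhood `U` such that `ω` is smooth on `U × U` and the action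
`(g, n) ↦ S(g)(n)` is smooth on `U × N`. -/
structure IsSmoothDomain (U : Set G) : Prop where
  isOpen : IsOpen U
  one_mem : 1 ∈ U
  inv_mem : ∀ g ∈ U, g⁻¹ ∈ U
  smooth_ω : SmoothOnSet 𝕜 (EG × EG) EN f.ω (U ×ˢ U)
  smooth_S : SmoothOnSet 𝕜 (EG × EN) EN (fun p : G × N => f.S p.1 p.2) (U ×ˢ univ)

theorem exists_isSmoothDomain [LocConvLieGroup 𝕜 EG G] : ∃ U : Set G, f.IsSmoothDomain U := by
  obtain ⟨W, hW, one_mem_W, hωW⟩ := f.isC2ss.1.2.2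
  obtain ⟨V, hV, one_mem_V, hSV⟩ := f.isC1Aut.locallySmooth
  obtain ⟨A, B, hA, hB, one_mem_A, one_mem_B, hAB⟩ := isOpen_prod_iff.1 hW 1 1 one_mem_W
  have continuous_inv : Continuous (fun g : G => g⁻¹) := continuous_iff_continuousAt.2 fun g =>
    (LocConvLieGroup.smooth_inv (𝕜 := 𝕜) (E := EG) g).continuousAt
  have hO : IsOpen (A ∩ B ∩ V) := (hA.inter hB).inter hV
  refine ⟨(A ∩ B ∩ V) ∩ (fun g => g⁻¹) ⁻¹' (A ∩ B ∩ V), hO.inter (hO.preimage continuous_inv),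
    by simp [one_mem_A, one_mem_B, one_mem_V], fun g ⟨hg, hg'⟩ => ⟨hg', by simpa using hg⟩,
    fun p hp => hωW p (hAB ⟨hp.1.1.1.1, hp.2.1.1.2⟩), fun p hp => hSV p ⟨hp.1.1.2, trivial⟩⟩

theorem IsSmoothDomain.smoothNear_ω [IsTopologicalAddGroup EG] [ContinuousSMul 𝕜 EG]
    [PolynormableSpace 𝕜 EG] [LocConvLieGroup 𝕜 EG G] [IsTopologicalAddGroup EN]
    [ContinuousSMul 𝕜 EN] [PolynormableSpace 𝕜 EN]
    {f : FactorSystem 𝕜 EG G EN N} {U : Set G} (hU : f.IsSmoothDomain U)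
    {E : Type*} [AddCommGroup E] [Module 𝕜 E] [TopologicalSpace E] [IsTopologicalAddGroup E]
    [ContinuousSMul 𝕜 E] {M : Type*} [TopologicalSpace M] [ChartedSpace E M]
    [SmoothManifold 𝕜 E M] {a b : M → G} {x : M}
    (ha : SmoothNear 𝕜 E EG a x) (hb : SmoothNear 𝕜 E EG b x) (hax : a x ∈ U) (hbx : b x ∈ U) :
    SmoothNear 𝕜 E EN (fun y => f.ω (a y, b y)) x :=
  (hU.smooth_ω (a x, b x) ⟨hax, hbx⟩).comp_of_eq (ha.prodMk hb) rfl

end FactorSystem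

end FactorSystem

section TwistedProduct

variable {𝕜 : Type w} [RCLike 𝕜]
  {EG : Type u} [AddCommGroup EG] [Module 𝕜 EG] [TopologicalSpace EG]
  [IsTopologicalAddGroup EG] [ContinuousSMul 𝕜 EG] [PolynormableSpace 𝕜 EG]
  {G : Type u} [Group G] [TopologicalSpace G] [ChartedSpace EG G] [LocConvLieGroup 𝕜 EG G]
  {EN : Type v} [AddCommGroup EN] [Module 𝕜 EN] [TopologicalSpace EN]
  [IsTopologicalAddGroup EN] [ContinuousSMul 𝕜 EN] [PolynormableSpace 𝕜 EN]
  {N : Type v} [Group N] [TopologicalSpace N] [ChartedSpace EN N] [LocConvLieGroup 𝕜 EN N]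

namespace TwistedProduct

variable {f : FactorSystem 𝕜 EG G EN N} (x y : TwistedProduct f)

@[simp] theorem fst_one : (1 : TwistedProduct f).fst = 1 := rfl

@[simp] theorem snd_one : (1 : TwistedProduct f).snd = 1 := rfl

@[simp] theorem fst_mul : (x * y).fst = x.fst * f.S x.snd y.fst * f.ω (x.snd, y.snd) := rfl

@[simp] theorem snd_mul : (x * y).snd = x.snd * y.snd := rfl

@[simp] theorem snd_inv : x⁻¹.snd = x.snd⁻¹ := rfl

@[simp] theorem fst_inl (n : N) : (inl f n).fst = n := rfl

@[simp] theorem snd_inl (n : N) : (inl f n).snd = 1 := rfl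

@[simp] theorem proj_apply : proj f x = x.snd := rfl

theorem fst_conj : (y * x * y⁻¹).fst = y.fst * f.S y.snd x.fst * (f.ω (y.snd, x.snd) *
    (f.ω (y.snd * x.snd * y.snd⁻¹, y.snd))⁻¹) * (f.S (y.snd * x.snd * y.snd⁻¹) y.fst)⁻¹ := by
  rw [← mul_assoc, eq_mul_inv_iff_mul_eq, eq_mul_inv_iff_mul_eq]
  have conj_mul := fst_mul (y * x * y⁻¹) y
  simpa only [inv_mul_cancel_right, fst_mul, snd_mul, snd_inv] using conj_mul.symm

theorem inl_range_eq_proj_ker : (inl f).range = (proj f).ker := by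
  ext x
  refine ⟨?_, fun hx => ⟨x.fst, TwistedProduct.ext rfl (Eq.symm hx)⟩⟩
  rintro ⟨n, rfl⟩
  rfl

end TwistedProduct

namespace FactorSystem

variable (f : FactorSystem 𝕜 EG G EN N)

theorem S_symm_apply (g : G) (n : N) :
    (f.S g).symm n = (f.ω (g⁻¹, g))⁻¹ * f.S g⁻¹ n * f.ω (g⁻¹, g) := by
  have h := f.mul_apply g⁻¹ g ((f.S g).symm n)
  rw [inv_mul_cancel, f.S_one, MulEquiv.apply_symm_apply, MulAut.one_apply] at h
  simp [h, mul_assoc]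

namespace IsSmoothDomain

variable {f} {U : Set G} (hU : f.IsSmoothDomain U)

section

variable {E : Type*} [AddCommGroup E] [Module 𝕜 E] [TopologicalSpace E]
  [IsTopologicalAddGroup E] [ContinuousSMul 𝕜 E] {M : Type*} [TopologicalSpace M]
  [ChartedSpace E M] [SmoothManifold 𝕜 E M]

include hU

theorem smoothNear_S {a : M → G} {b : M → N} {x : M} (ha : SmoothNear 𝕜 E EG a x)
    (hb : SmoothNear 𝕜 E EN b x) (hax : a x ∈ U) :
    SmoothNear 𝕜 E EN (fun y => f.S (a y) (b y)) x :=
  (hU.smooth_S (a x, b x) ⟨hax, trivial⟩).comp_of_eq (ha.prodMk hb) rfl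

theorem smoothNear_S_symm {a : M → G} {b : M → N} {x : M} (ha : SmoothNear 𝕜 E EG a x)
    (hb : SmoothNear 𝕜 E EN b x) (hax : a x ∈ U) :
    SmoothNear 𝕜 E EN (fun y => (f.S (a y)).symm (b y)) x := by
  simp only [S_symm_apply]
  have inv_mem := hU.inv_mem _ hax
  have smooth_ω := hU.smoothNear_ω ha.inv ha inv_mem hax
  exact (smooth_ω.inv.mul (hU.smoothNear_S ha.inv hb inv_mem)).mul smooth_ω

-- The cocycle identity at `(a y * (a x)⁻¹, a x, g)` expresses `ω (a y, g)` by values of `ω` and `S`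
-- with both arguments in `U`, up to constants, even though `g` need not lie in `U`.
theorem smoothNear_ω_const_right {a : M → G} {x : M} (ha : SmoothNear 𝕜 E EG a x) {g : G}
    (hax : a x ∈ U) (haxg : a x * g ∈ U) : SmoothNear 𝕜 E EN (fun y => f.ω (a y, g)) x := by
  have smooth_w : SmoothNear 𝕜 E EG (fun y => a y * (a x)⁻¹) x := ha.mul (SmoothNear.const _ _)
  have hw : a x * (a x)⁻¹ ∈ U := by simpa using hU.one_mem
  have ω_eq (y : M) : f.ω (a y, g) = (f.ω (a y * (a x)⁻¹, a x))⁻¹ *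
      (f.S (a y * (a x)⁻¹) (f.ω (a x, g)) * f.ω (a y * (a x)⁻¹, a x * g)) := by
    rw [f.cocycle, inv_mul_cancel_right, inv_mul_cancel_left]
  rw [funext ω_eq]
  exact (hU.smoothNear_ω smooth_w (SmoothNear.const _ _) hw hax).inv.mul
    ((hU.smoothNear_S smooth_w (SmoothNear.const _ _) hw).mul
      (hU.smoothNear_ω smooth_w (SmoothNear.const _ _) hw haxg))

end

/-- The identification of `{(n, g) | g ∈ U}` in `N ×_(S,ω) G` with `N × U`, from which the manifold
structure of `N ×_(S,ω) G` is glued. -/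
def translationPatch : TranslationPatch 𝕜 (EN × EG) (N × G) (TwistedProduct f) where
  patch :=
    { toFun := fun x => (x.fst, x.snd)
      invFun := fun p => ⟨p.1, p.2⟩
      source := {x | x.snd ∈ U}
      target := {p | p.2 ∈ U}
      map_source' := fun _ hx => hx
      map_target' := fun _ hp => hp
      left_inv' := fun _ _ => rfl
      right_inv' := fun _ _ => rfl }
  one_mem_source := hU.one_mem
  isOpen_translation_source t := by
    have continuous_mul : Continuous fun p : N × G => p.2 * t.snd :=
      continuous_iff_continuousAt.2 fun p =>
        ((SmoothNear.snd (𝕜 := 𝕜) (E := EN) (F := EG) p).mul (SmoothNear.const _ _)).continuousAt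
    exact (hU.isOpen.preimage continuous_snd).inter (hU.isOpen.preimage continuous_mul)
  smooth_translation t p hp := by
    have fst : SmoothNear 𝕜 (EN × EG) EN (fun p : N × G => p.1) p := SmoothNear.fst p
    have snd : SmoothNear 𝕜 (EN × EG) EG (fun p : N × G => p.2) p := SmoothNear.snd p
    exact ((fst.mul (hU.smoothNear_S snd (SmoothNear.const t.fst _) hp.1)).mul
      (hU.smoothNear_ω_const_right snd hp.1 hp.2)).prodMk (snd.mul (SmoothNear.const t.snd _))

theorem smoothNear_fst {x : TwistedProduct f} (hx : x.snd ∈ U) :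
    letI := hU.translationPatch.topologicalSpace
    letI := hU.translationPatch.chartedSpace
    SmoothNear 𝕜 (EN × EG) EN TwistedProduct.fst x := by
  let := hU.translationPatch.topologicalSpace
  let := hU.translationPatch.chartedSpace
  exact (SmoothNear.fst _).comp_of_eq (hU.translationPatch.smoothOnSet_patch x hx) rfl

theorem smoothNear_snd {x : TwistedProduct f} (hx : x.snd ∈ U) :
    letI := hU.translationPatch.topologicalSpace
    letI := hU.translationPatch.chartedSpace
    SmoothNear 𝕜 (EN × EG) EG TwistedProduct.snd x := by
  let := hU.translationPatch.topologicalSpace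
  let := hU.translationPatch.chartedSpace
  exact (SmoothNear.snd _).comp_of_eq (hU.translationPatch.smoothOnSet_patch x hx) rfl

theorem smoothNear_mk {E : Type*} [AddCommGroup E] [Module 𝕜 E] [TopologicalSpace E]
    [IsTopologicalAddGroup E] [ContinuousSMul 𝕜 E] {M : Type*} [TopologicalSpace M]
    [ChartedSpace E M] [SmoothManifold 𝕜 E M] {a : M → N} {b : M → G} {x : M}
    (ha : SmoothNear 𝕜 E EN a x) (hb : SmoothNear 𝕜 E EG b x) (hbx : b x ∈ U) :
    letI := hU.translationPatch.topologicalSpace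
    letI := hU.translationPatch.chartedSpace
    SmoothNear 𝕜 E (EN × EG) (fun y => (⟨a y, b y⟩ : TwistedProduct f)) x := by
  let := hU.translationPatch.topologicalSpace
  let := hU.translationPatch.chartedSpace
  exact (hU.translationPatch.smoothOnSet_patch_symm (a x, b x) hbx).comp_of_eq (ha.prodMk hb) rfl

variable [T2Space EG] [T2Space EN]

theorem locConvLieGroup :
    letI := hU.translationPatch.topologicalSpace
    letI := hU.translationPatch.chartedSpace
    LocConvLieGroup 𝕜 (EN × EG) (TwistedProduct f) := by
  let := hU.translationPatch.topologicalSpace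
  let := hU.translationPatch.chartedSpace
  have := hU.translationPatch.smoothManifold
  have fst_one := hU.smoothNear_fst (x := 1) hU.one_mem
  have snd_one := hU.smoothNear_snd (x := 1) hU.one_mem
  have one_inv_mem : (1 : G)⁻¹ ∈ U := hU.inv_mem 1 hU.one_mem
  refine LocConvLieGroup.of_smoothNear_one hU.translationPatch.smoothMap_mul_right ?_ ?_ fun y => ?_
  · let one : TwistedProduct f × TwistedProduct f := 1
    have fst := SmoothNear.fst (𝕜 := 𝕜) (E := EN × EG) (F := EN × EG) one
    have snd := SmoothNear.snd (𝕜 := 𝕜) (E := EN × EG) (F := EN × EG) one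
    have fst_left := fst_one.comp_of_eq fst rfl
    have snd_left := snd_one.comp_of_eq fst rfl
    have fst_right := fst_one.comp_of_eq snd rfl
    have snd_right := snd_one.comp_of_eq snd rfl
    exact hU.smoothNear_mk ((fst_left.mul (hU.smoothNear_S snd_left fst_right hU.one_mem)).mul
      (hU.smoothNear_ω snd_left snd_right hU.one_mem hU.one_mem)) (snd_left.mul snd_right)
      (by simpa using hU.one_mem)
  · exact hU.smoothNear_mk ((hU.smoothNear_ω snd_one.inv snd_one one_inv_mem hU.one_mem).inv.mul
      (hU.smoothNear_S snd_one.inv fst_one.inv one_inv_mem)) snd_one.inv one_inv_mem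
  · have snd_conj := ((SmoothNear.const y.snd _).mul snd_one).mul (SmoothNear.const y.snd⁻¹ _)
    have snd_conj_mem : y.snd * 1 * y.snd⁻¹ ∈ U := by simpa using hU.one_mem
    have smooth_ω := (locallySmoothAt_iff.1 (f.isC2ss.2 y.snd)).comp_of_eq snd_one rfl
    have smooth_S := ((f.isC1Aut.lieAut y.snd).1 _).comp_of_eq fst_one rfl
    have fst_conj := (((SmoothNear.const y.fst _).mul smooth_S).mul smooth_ω).mul
      (hU.smoothNear_S snd_conj (SmoothNear.const y.fst _) snd_conj_mem).inv
    exact (hU.smoothNear_mk fst_conj snd_conj snd_conj_mem).congr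
      (Eventually.of_forall fun x => TwistedProduct.ext (x.fst_conj y).symm rfl)

theorem isLieExtension :
    letI := hU.translationPatch.topologicalSpace
    letI := hU.translationPatch.chartedSpace
    IsLieExtension 𝕜 EG EN (EN × EG) (TwistedProduct.inl f) (TwistedProduct.proj f) := by
  let := hU.translationPatch.topologicalSpace
  let := hU.translationPatch.chartedSpace
  have := hU.locConvLieGroup
  refine IsLieExtension.of_principal_one
    (hU.smoothNear_mk (SmoothNear.id 1) (SmoothNear.const 1 _) hU.one_mem)
    (hU.smoothNear_snd hU.one_mem) (fun n n' h => congrArg TwistedProduct.fst h)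
    TwistedProduct.inl_range_eq_proj_ker (fun g => ⟨⟨1, g⟩, rfl⟩) hU.isOpen hU.one_mem
    (σ := fun y => ⟨1, y⟩)
    (fun y hy => hU.smoothNear_mk (SmoothNear.const _ _) (SmoothNear.id y) hy)
    (fun y _ => rfl) (τ := fun x => (f.S x.snd).symm x.fst)
    (fun x hx => hU.smoothNear_S_symm (hU.smoothNear_snd hx) (hU.smoothNear_fst hx) hx)
    fun x _ => TwistedProduct.ext ?_ ?_ <;> simp

end IsSmoothDomain

variable [T2Space EG] [T2Space EN]

theorem nonempty_twistedLieStructure : Nonempty (TwistedLieStructure f) := by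
  obtain ⟨U, hU⟩ := f.exists_isSmoothDomain
  let := hU.translationPatch.topologicalSpace
  let := hU.translationPatch.chartedSpace
  have := hU.locConvLieGroup
  exact ⟨{ model := EN × EG
           isLieExtension := hU.isLieExtension
           smooth_mk := ⟨U, hU.isOpen, hU.one_mem, fun p hp =>
            hU.smoothNear_mk (SmoothNear.fst p) (SmoothNear.snd p) hp.2⟩ }⟩

end FactorSystem

end TwistedProduct

section InducedFactorSystem

variable {𝕜 : Type w} [RCLike 𝕜]
  {EG : Type u} [AddCommGroup EG] [Module 𝕜 EG] [TopologicalSpace EG]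
  {G : Type u} [Group G] [TopologicalSpace G] [ChartedSpace EG G]
  {EN : Type v} [AddCommGroup EN] [Module 𝕜 EN] [TopologicalSpace EN]
  {N : Type v} [Group N] [TopologicalSpace N] [ChartedSpace EN N]
  {f f' : FactorSystem 𝕜 EG G EN N} {X Y : LieExtension 𝕜 EG G EN N} {ρ : G → X.carrier}

/-- `ρ` is a normalized locally smooth section of the extension `X` which induces the factor system
`(S, ω)`: conjugation by `ρ(g)` is `S(g)` on `N`, and `ω(g, g') = ρ(g) ρ(g') ρ(gg')⁻¹`. -/
structure FactorSystem.IsInducedBy (f : FactorSystem 𝕜 EG G EN N) (X : LieExtension 𝕜 EG G EN N)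
    (ρ : G → X.carrier) : Prop where
  isC1 : IsC1 𝕜 EG X.model ρ
  q_apply : ∀ g, X.q (ρ g) = g
  ι_S_mul : ∀ g n, X.ι (f.S g n) * ρ g = ρ g * X.ι n
  ι_ω_mul : ∀ g g', X.ι (f.ω (g, g')) * ρ (g * g') = ρ g * ρ g'

theorem FactorSystem.IsInducedBy.corresponds (h : f.IsInducedBy X ρ) {S : G → MulAut N}
    (hS : OuterEquiv 𝕜 EG EN S f.S) : X.Corresponds 𝕜 EG EN S :=
  ⟨ρ, h.isC1, h.q_apply, f.S, fun g n => eq_mul_inv_of_mul_eq (h.ι_S_mul g n), hS⟩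

theorem FactorSystem.IsInducedBy.map [IsTopologicalAddGroup EG] [ContinuousSMul 𝕜 EG]
    (h : f.IsInducedBy X ρ) {φ : X.carrier →* Y.carrier}
    (smooth_φ : SmoothMap 𝕜 X.model Y.model φ) (φ_ι : ∀ n, φ (X.ι n) = Y.ι n)
    (q_φ : ∀ x, Y.q (φ x) = X.q x) : f.IsInducedBy Y (φ ∘ ρ) where
  isC1 := ⟨by simp [h.isC1.1],
    locallySmoothAt_iff.2 (SmoothNear.comp (g := φ) (smooth_φ _) (locallySmoothAt_iff.1 h.isC1.2))⟩
  q_apply g := (q_φ _).trans (h.q_apply g)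
  ι_S_mul g n := by simpa [φ_ι] using congrArg φ (h.ι_S_mul g n)
  ι_ω_mul g g' := by simpa [φ_ι] using congrArg φ (h.ι_ω_mul g g')

/-- The section `g ↦ (h(g), g)` of `N ×_(S',ω') G` induces `(S, ω)`; equivalently,
`(n, g) ↦ (n h(g), g)` is an equivalence of `N ×_(S,ω) G` with `N ×_(S',ω') G`. -/
structure FactorSystem.Intertwines (f f' : FactorSystem 𝕜 EG G EN N) (h : G → N) : Prop where
  isC1 : IsC1 𝕜 EG EN h
  S_mul : ∀ g n, f.S g n * h g = h g * f'.S g n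
  ω_mul : ∀ g g', f.ω (g, g') * h (g * g') = h g * f'.S g (h g') * f'.ω (g, g')

theorem IsC1.one : IsC1 𝕜 EG EN (1 : G → N) :=
  ⟨rfl, locallySmoothAt_iff.2 (SmoothNear.const _ _)⟩

theorem FactorSystem.Intertwines.refl (f : FactorSystem 𝕜 EG G EN N) : f.Intertwines f 1 :=
  ⟨IsC1.one, fun g n => by simp, fun g g' => by simp⟩

variable [IsTopologicalAddGroup EG] [ContinuousSMul 𝕜 EG] [PolynormableSpace 𝕜 EG]
  [LocConvLieGroup 𝕜 EG G] [IsTopologicalAddGroup EN] [ContinuousSMul 𝕜 EN]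
  [PolynormableSpace 𝕜 EN] [LocConvLieGroup 𝕜 EN N]

namespace TwistedLieStructure

variable (L : TwistedLieStructure f)

theorem smoothNear_mk {E : Type*} [AddCommGroup E] [Module 𝕜 E] [TopologicalSpace E]
    [IsTopologicalAddGroup E] [ContinuousSMul 𝕜 E] {M : Type*} [TopologicalSpace M]
    [ChartedSpace E M] [SmoothManifold 𝕜 E M] {a : M → N} {b : M → G} {x : M}
    (ha : SmoothNear 𝕜 E EN a x) (hb : SmoothNear 𝕜 E EG b x) (hbx : b x = 1) :
    SmoothNear 𝕜 E L.toLieExtension.model (M' := L.toLieExtension.carrier)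
      (fun y => (⟨a y, b y⟩ : TwistedProduct f)) x := by
  obtain ⟨U, -, one_mem, smooth_mk⟩ := L.smooth_mk
  have smoothNear_mk : SmoothNear 𝕜 (EN × EG) L.toLieExtension.model
      (M' := L.toLieExtension.carrier) (fun p : N × G => (⟨p.1, p.2⟩ : TwistedProduct f))
      (a x, 1) := smooth_mk (a x, 1) ⟨trivial, one_mem⟩
  exact smoothNear_mk.comp_of_eq (f := fun y => (a y, b y)) (ha.prodMk hb) (by rw [hbx])

theorem smoothNear_snd (x : L.toLieExtension.carrier) :
    SmoothNear 𝕜 L.toLieExtension.model EG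
      (fun x : L.toLieExtension.carrier => TwistedProduct.snd (f := f) x) x :=
  L.toLieExtension.isLieExtension.smooth_q x

theorem smoothNear_fst : SmoothNear 𝕜 L.toLieExtension.model EN
    (fun x : L.toLieExtension.carrier => TwistedProduct.fst (f := f) x) 1 := by
  have inl_fst (x : TwistedProduct f) :
      TwistedProduct.inl f x.fst = x * (⟨1, x.snd⟩ : TwistedProduct f)⁻¹ := by
    rw [eq_mul_inv_iff_mul_eq]
    ext <;> simp
  have smooth_mul_inv := (SmoothNear.id (𝕜 := 𝕜) (E := L.toLieExtension.model) 1).mul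
    (L.smoothNear_mk (SmoothNear.const (1 : N) _) (L.smoothNear_snd 1) rfl).inv
  exact L.toLieExtension.isLieExtension.smoothNear_of_ι
    (smooth_mul_inv.congr (Eventually.of_forall fun x => (inl_fst x).symm))

theorem isInducedBy_mk_iff {h : G → N} :
    f'.IsInducedBy L.toLieExtension (fun g => (⟨h g, g⟩ : TwistedProduct f)) ↔
      f'.Intertwines f h := by
  constructor
  · intro H
    refine ⟨⟨congrArg TwistedProduct.fst H.isC1.1, locallySmoothAt_iff.2
      (L.smoothNear_fst.comp_of_eq (locallySmoothAt_iff.1 H.isC1.2) H.isC1.1)⟩,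
      fun g n => ?_, fun g g' => ?_⟩
    · have conj : TwistedProduct.inl f (f'.S g n) * ⟨h g, g⟩ = ⟨h g, g⟩ * TwistedProduct.inl f n :=
        H.ι_S_mul g n
      simpa using congrArg TwistedProduct.fst conj
    · have mul : TwistedProduct.inl f (f'.ω (g, g')) * ⟨h (g * g'), g * g'⟩ =
          ⟨h g, g⟩ * ⟨h g', g'⟩ := H.ι_ω_mul g g'
      simpa using congrArg TwistedProduct.fst mul
  · intro H
    refine ⟨⟨TwistedProduct.ext H.isC1.1 rfl, locallySmoothAt_iff.2 (L.smoothNear_mk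
      (locallySmoothAt_iff.1 H.isC1.2) (SmoothNear.id 1) rfl)⟩, fun g => rfl,
      fun g n => ?_, fun g g' => ?_⟩
    · change TwistedProduct.inl f (f'.S g n) * ⟨h g, g⟩ = ⟨h g, g⟩ * TwistedProduct.inl f n
      ext <;> simp [H.S_mul]
    · change TwistedProduct.inl f (f'.ω (g, g')) * ⟨h (g * g'), g * g'⟩ = ⟨h g, g⟩ * ⟨h g', g'⟩
      ext <;> simp [H.ω_mul]

end TwistedLieStructure

namespace FactorSystem.IsInducedBy

/-- The homomorphism `N ×_(S,ω) G → X`, `(n, g) ↦ ι(n) ρ(g)`, comparing `N ×_(S,ω) G` with an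
extension whose section `ρ` induces `(S, ω)`. -/
def hom (h : f.IsInducedBy X ρ) : TwistedProduct f →* X.carrier :=
  MonoidHom.mk' (fun x => X.ι x.fst * ρ x.snd) fun x y => by
    simp only [TwistedProduct.fst_mul, TwistedProduct.snd_mul, map_mul, mul_assoc, h.ι_ω_mul]
    rw [← mul_assoc (X.ι (f.S _ _)), h.ι_S_mul, mul_assoc]

theorem hom_inl (h : f.IsInducedBy X ρ) (n : N) : h.hom (TwistedProduct.inl f n) = X.ι n := by
  simp [hom, h.isC1.1]

theorem q_hom (h : f.IsInducedBy X ρ) (x : TwistedProduct f) : X.q (h.hom x) = x.snd := by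
  simp [hom, X.isLieExtension.q_ι, h.q_apply]

theorem equivalent (h : f.IsInducedBy X ρ) (L : TwistedLieStructure f) :
    L.toLieExtension.Equivalent X := by
  let φ : L.toLieExtension.carrier →* X.carrier := h.hom
  refine ⟨φ, smoothMap_of_smoothNear_one φ ?_, h.hom_inl, h.q_hom⟩
  exact (SmoothNear.comp (F := EN) (X.isLieExtension.smooth_ι _) L.smoothNear_fst).mul
    ((locallySmoothAt_iff.1 h.isC1.2).comp_of_eq (L.smoothNear_snd 1) rfl)

end FactorSystem.IsInducedBy

namespace TwistedLieStructure

variable (L : TwistedLieStructure f)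

theorem equivalent_iff_exists_isInducedBy :
    L.toLieExtension.Equivalent X ↔ ∃ ρ, f.IsInducedBy X ρ :=
  ⟨fun ⟨_, smooth_φ, φ_ι, q_φ⟩ =>
    ⟨_, (L.isInducedBy_mk_iff.2 (.refl f)).map smooth_φ φ_ι q_φ⟩, fun ⟨_, h⟩ => h.equivalent L⟩

theorem equivalent_iff_exists_intertwines (L' : TwistedLieStructure f') :
    L.toLieExtension.Equivalent L'.toLieExtension ↔ ∃ h, f.Intertwines f' h := by
  refine L.equivalent_iff_exists_isInducedBy.trans ⟨fun ⟨ρ, hρ⟩ => ?_, fun ⟨h, H⟩ =>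
    ⟨_, L'.isInducedBy_mk_iff.2 H⟩⟩
  let h (g : G) : N := TwistedProduct.fst (f := f') (ρ g)
  have ρ_eq : ρ = fun g => (⟨h g, g⟩ : TwistedProduct f') :=
    funext fun g => TwistedProduct.ext rfl (hρ.q_apply g)
  exact ⟨h, L'.isInducedBy_mk_iff.1 (ρ_eq ▸ hρ)⟩

end TwistedLieStructure

theorem LieExtension.isC2ss_of_ι_eq {ω : G × G → N} (hρ : IsC1 𝕜 EG X.model ρ)
    (ι_ω : ∀ p, X.ι (ω p) = ρ p.1 * ρ p.2 * (ρ (p.1 * p.2))⁻¹) : IsC2ss 𝕜 EG EN ω := by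
  have hX := X.isLieExtension
  have smooth_ρ : SmoothNear 𝕜 EG X.model ρ 1 := locallySmoothAt_iff.1 hρ.2
  refine isC2ss_iff.2 ⟨fun g => hX.injective (by simp [ι_ω, hρ.1]),
    fun g => hX.injective (by simp [ι_ω, hρ.1]),
    hX.smoothNear_of_ι ?_, fun g => hX.smoothNear_of_ι ?_⟩
  · have smooth_fst := SmoothNear.fst (𝕜 := 𝕜) (E := EG) (F := EG) (1 : G × G)
    have smooth_snd := SmoothNear.snd (𝕜 := 𝕜) (E := EG) (F := EG) (1 : G × G)
    simp only [ι_ω]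
    exact ((smooth_ρ.comp_of_eq smooth_fst rfl).mul (smooth_ρ.comp_of_eq smooth_snd rfl)).mul
      (smooth_ρ.comp_of_eq (smooth_fst.mul smooth_snd) (by simp)).inv
  · have ι_eq (x : G) : ρ g * ρ x * (ρ g)⁻¹ * (ρ (g * x * g⁻¹))⁻¹ =
        X.ι (ω (g, x) * (ω (g * x * g⁻¹, g))⁻¹) := by
      simp only [map_mul, map_inv, ι_ω, inv_mul_cancel_right]
      group
    have smooth_conj : SmoothNear 𝕜 EG EG (fun x => g * x * g⁻¹) 1 :=
      ((SmoothNear.const g _).mul (SmoothNear.id 1)).mul (SmoothNear.const g⁻¹ _)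
    exact ((((SmoothNear.const _ _).mul smooth_ρ).mul (SmoothNear.const _ _)).mul
      (smooth_ρ.comp_of_eq smooth_conj (by simp)).inv).congr (Eventually.of_forall ι_eq)

theorem LieExtension.exists_isInducedBy {S : G → MulAut N} (hS : IsC1Aut 𝕜 EG EN S)
    (hρ : IsC1 𝕜 EG X.model ρ) (q_ρ : ∀ g, X.q (ρ g) = g)
    (ι_S : ∀ g n, X.ι (S g n) = ρ g * X.ι n * (ρ g)⁻¹) :
    ∃ f : FactorSystem 𝕜 EG G EN N, f.S = S ∧ f.IsInducedBy X ρ := by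
  have hX := X.isLieExtension
  have exists_ω (p : G × G) : ∃ n, X.ι n = ρ p.1 * ρ p.2 * (ρ (p.1 * p.2))⁻¹ :=
    hX.exists_ι_eq (by simp [q_ρ])
  choose ω ι_ω using exists_ω
  refine ⟨⟨S, ω, hS, isC2ss_of_ι_eq hρ ι_ω, fun g g' => ?_, fun g g' g'' => hX.injective ?_⟩, rfl,
    hρ, q_ρ, fun g n => by rw [ι_S, inv_mul_cancel_right],
    fun g g' => by rw [ι_ω, inv_mul_cancel_right]⟩
  · rw [deltaAut, mul_inv_eq_iff_eq_mul]
    ext n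
    apply hX.injective
    simp only [MulAut.mul_apply, MulAut.conj_apply, ι_S, map_mul, map_inv, ι_ω]
    group
  · simp only [d2, ι_S, map_mul, map_inv, ι_ω, map_one, mul_assoc g g' g'']
    group

theorem LieExtension.Corresponds.exists_isInducedBy {S : G → MulAut N} (hS : IsC1Aut 𝕜 EG EN S)
    (h : X.Corresponds 𝕜 EG EN S) :
    ∃ f : FactorSystem 𝕜 EG G EN N, f.S = S ∧ ∃ ρ, f.IsInducedBy X ρ := by
  obtain ⟨σ, hσ, q_σ, S', ι_S', k, hk, S'_eq⟩ := h
  have smooth_ι_k := SmoothNear.comp (F := EN) (X.isLieExtension.smooth_ι _)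
    (locallySmoothAt_iff.1 hk.2)
  have ι_S (g : G) (n : N) :
      X.ι (S g n) = (X.ι (k g))⁻¹ * σ g * X.ι n * ((X.ι (k g))⁻¹ * σ g)⁻¹ := by
    have ι_S'_eq := ι_S' g n
    rw [S'_eq, MulAut.mul_apply, MulAut.conj_apply, map_mul, map_mul, map_inv,
      mul_inv_eq_iff_eq_mul, ← eq_inv_mul_iff_mul_eq] at ι_S'_eq
    rw [ι_S'_eq]
    group
  obtain ⟨f, hf, h⟩ := LieExtension.exists_isInducedBy hS (ρ := fun g => (X.ι (k g))⁻¹ * σ g)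
    ⟨by simp [hk.1, hσ.1], locallySmoothAt_iff.2 (smooth_ι_k.inv.mul (locallySmoothAt_iff.1 hσ.2))⟩
    (fun g => by simp [X.isLieExtension.q_ι, q_σ]) ι_S
  exact ⟨f, hf, _, h⟩

end InducedFactorSystem

section ExtensionClasses

variable {𝕜 : Type w} [RCLike 𝕜]
  {EG : Type u} [AddCommGroup EG] [Module 𝕜 EG] [TopologicalSpace EG]
  [IsTopologicalAddGroup EG] [ContinuousSMul 𝕜 EG] [PolynormableSpace 𝕜 EG] [T2Space EG]
  {G : Type u} [Group G] [TopologicalSpace G] [ChartedSpace EG G] [LocConvLieGroup 𝕜 EG G]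
  {EN : Type v} [AddCommGroup EN] [Module 𝕜 EN] [TopologicalSpace EN]
  [IsTopologicalAddGroup EN] [ContinuousSMul 𝕜 EN] [PolynormableSpace 𝕜 EN] [T2Space EN]
  {N : Type v} [Group N] [TopologicalSpace N] [ChartedSpace EN N] [LocConvLieGroup 𝕜 EN N]
  {S : G → MulAut N}

namespace FactorSystem

variable (f : FactorSystem 𝕜 EG G EN N) {f' : FactorSystem 𝕜 EG G EN N}

/-- The class `[N ×_(S,ω) G]` in `Ext(G, N)`, formed with an arbitrary choice of the Lie group
structure; by `isTwistedClass_iff` it does not depend on this choice. -/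
noncomputable def extClass : ExtClasses 𝕜 EG G EN N :=
  ⟦f.nonempty_twistedLieStructure.some.toLieExtension⟧

variable {f}

theorem extClass_eq_mk_iff {X : LieExtension 𝕜 EG G EN N} :
    f.extClass = ⟦X⟧ ↔ ∃ ρ, f.IsInducedBy X ρ :=
  Quotient.eq.trans (TwistedLieStructure.equivalent_iff_exists_isInducedBy _)

theorem extClass_eq_extClass_iff : f.extClass = f'.extClass ↔ ∃ h, f.Intertwines f' h :=
  Quotient.eq.trans (TwistedLieStructure.equivalent_iff_exists_intertwines _ _)

theorem extClass_mem_extKernel (hf : OuterEquiv 𝕜 EG EN S f.S) :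
    f.extClass ∈ ExtKernel 𝕜 EG EN S := by
  obtain ⟨ρ, hρ⟩ := extClass_eq_mk_iff.1 (rfl : f.extClass = _)
  exact ⟨_, rfl, hρ.corresponds hf⟩

end FactorSystem

theorem isTwistedClass_iff {f : FactorSystem 𝕜 EG G EN N} {e : ExtClasses 𝕜 EG G EN N} :
    IsTwistedClass f e ↔ e = f.extClass := by
  refine ⟨?_, fun h => ⟨_, h.symm⟩⟩
  rintro ⟨L, rfl⟩
  exact Quotient.sound ((L.equivalent_iff_exists_intertwines _).2 ⟨1, .refl f⟩)

theorem exists_extClass_eq (hS : IsC1Aut 𝕜 EG EN S) {e : ExtClasses 𝕜 EG G EN N}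
    (he : e ∈ ExtKernel 𝕜 EG EN S) : ∃ f : FactorSystem 𝕜 EG G EN N, f.S = S ∧ f.extClass = e := by
  obtain ⟨X, rfl, hX⟩ := he
  obtain ⟨f, hf, hρ⟩ := hX.exists_isInducedBy hS
  exact ⟨f, hf, FactorSystem.extClass_eq_mk_iff.2 hρ⟩

end ExtensionClasses

section CentralCochains

variable {G N : Type*} [Group G] [Group N]

theorem mul_mul_eq_mul_mul_iff_of_center (n : N) (b c₁ c₂ c₁₂ : Subgroup.center N) :
    n * b * c₁₂ = c₁ * c₂ * n ↔ (b : N) = c₂ * (c₁₂ : N)⁻¹ * c₁ := by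
  rw [← Subgroup.coe_mul _ c₁ c₂, ← Subgroup.mem_center_iff.1 (c₁ * c₂).2, mul_assoc,
    mul_right_inj]
  norm_cast
  rw [← eq_mul_inv_iff_mul_eq, mul_comm c₁, mul_right_comm]

theorem d2_mul_of_mem_center (S : G → MulAut N) (ω : G × G → N) {β : G × G → N}
    (hβ : ∀ p, β p ∈ Subgroup.center N) (g g' g'' : G) :
    d2 S (fun p => ω p * β p) g g' g'' = d2 S ω g g' g'' * d2 S β g g' g'' := by
  have commute {z : N} (hz : z ∈ Subgroup.center N) (n : N) : Commute z n :=
    (Subgroup.mem_center_iff.1 hz n).symm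
  have mem₁ := map_center (S g) (hβ (g', g''))
  have mem₂ := mul_mem mem₁ (hβ (g, g' * g''))
  have mem₃ := mul_mem mem₂ (inv_mem (hβ (g * g', g'')))
  simp only [d2, map_mul]
  rw [(commute mem₁ _).mul_mul_mul_comm,
    (commute (hβ (g * g', g'')) _).symm.mul_inv, (commute mem₂ _).mul_mul_mul_comm,
    (commute (hβ (g, g')) _).symm.mul_inv, (commute mem₃ _).mul_mul_mul_comm]

end CentralCochains

section Twist

variable {𝕜 : Type w} [RCLike 𝕜]
  {EG : Type u} [AddCommGroup EG] [Module 𝕜 EG] [TopologicalSpace EG]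
  {G : Type u} [Group G] [TopologicalSpace G] [ChartedSpace EG G]
  {EN : Type v} [AddCommGroup EN] [Module 𝕜 EN] [TopologicalSpace EN]
  {N : Type v} [Group N] [TopologicalSpace N] [ChartedSpace EN N]
  {S S' : G → MulAut N}

theorem OuterEquiv.of_eq (h : S' = S) : OuterEquiv 𝕜 EG EN S S' :=
  ⟨1, IsC1.one, fun g => by simp [h]⟩

theorem FactorSystem.ext {f f' : FactorSystem 𝕜 EG G EN N} (hS : f.S = f'.S)
    (hω : ∀ p, f.ω p = f'.ω p) : f = f' := by
  cases f
  cases f'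
  congr
  exact funext hω

theorem FactorSystem.inv_ω_mul_ω_mem_center {f f' : FactorSystem 𝕜 EG G EN N} (hS : f'.S = f.S)
    (p : G × G) : (f.ω p)⁻¹ * f'.ω p ∈ Subgroup.center N := by
  obtain ⟨g, g'⟩ := p
  have conj_eq : MulAut.conj (f.ω (g, g')) = MulAut.conj (f'.ω (g, g')) := by
    rw [← f.delta_eq, ← f'.delta_eq, hS]
  refine Subgroup.mem_center_iff.2 fun n => ?_
  have conj_apply := DFunLike.congr_fun conj_eq n
  rw [MulAut.conj_apply, MulAut.conj_apply, eq_mul_inv_iff_mul_eq] at conj_apply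
  rw [mul_assoc, eq_inv_mul_iff_mul_eq, ← conj_apply]
  group

theorem FactorSystem.Intertwines.mem_center {f f' : FactorSystem 𝕜 EG G EN N} {h : G → N}
    (H : f.Intertwines f' h) (hS : f.S = f'.S) (g : G) : h g ∈ Subgroup.center N := by
  refine Subgroup.mem_center_iff.2 fun n => ?_
  obtain ⟨m, rfl⟩ := (f'.S g).surjective n
  simpa only [hS] using H.S_mul g m

variable [IsTopologicalAddGroup EG] [ContinuousSMul 𝕜 EG] [LocConvLieGroup 𝕜 EG G]
  [IsTopologicalAddGroup EN] [ContinuousSMul 𝕜 EN] [PolynormableSpace 𝕜 EN]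
  [LocConvLieGroup 𝕜 EN N]

theorem IsC2ss.of_mul_central {ω β : G × G → N} (hω : IsC2ss 𝕜 EG EN ω)
    (hωβ : IsC2ss 𝕜 EG EN (fun p => ω p * β p)) (hβ : ∀ p, β p ∈ Subgroup.center N) :
    IsC2ss 𝕜 EG EN β := by
  rw [isC2ss_iff] at *
  obtain ⟨ω_one_right, ω_one_left, smooth_ω, smooth_ω'⟩ := hω
  obtain ⟨ωβ_one_right, ωβ_one_left, smooth_ωβ, smooth_ωβ'⟩ := hωβ
  refine ⟨fun g => ?_, fun g => ?_,
    (smooth_ω.inv.mul smooth_ωβ).congr (Eventually.of_forall fun p => inv_mul_cancel_left _ _),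
    fun g => ((smooth_ω' g).inv.mul (smooth_ωβ' g)).congr (Eventually.of_forall fun x => ?_)⟩
  · simpa [ω_one_right] using ωβ_one_right g
  · simpa [ω_one_left] using ωβ_one_left g
  · have central := Subgroup.mem_center_iff.1
      (mul_mem (hβ (g, x)) (inv_mem (hβ (g * x * g⁻¹, g)))) (ω (g * x * g⁻¹, g))
    refine (mul_inv_eq_iff_eq_mul.2 central).symm.trans ?_ |>.symm
    group

namespace FactorSystem

variable [PolynormableSpace 𝕜 EG] {f f' : FactorSystem 𝕜 EG G EN N}

theorem twist_one (hf : OuterEquiv 𝕜 EG EN S f.S) : f.twist hf 1 = f :=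
  FactorSystem.ext rfl fun _ => mul_one _

theorem twist_twist (hf : OuterEquiv 𝕜 EG EN S f.S) (β β' : Z2ss 𝕜 EG EN S)
    (hf' : OuterEquiv 𝕜 EG EN S (f.twist hf β).S) :
    (f.twist hf β).twist hf' β' = f.twist hf (β * β') :=
  FactorSystem.ext rfl fun _ => mul_assoc _ _ _

theorem exists_twist_eq (hf : OuterEquiv 𝕜 EG EN S f.S) (hS : f'.S = f.S) :
    ∃ β : Z2ss 𝕜 EG EN S, f.twist hf β = f' := by
  have mem_center := inv_ω_mul_ω_mem_center hS
  have ω_mul (p : G × G) : f.ω p * ((f.ω p)⁻¹ * f'.ω p) = f'.ω p := mul_inv_cancel_left _ _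
  have isC2ss : IsC2ss 𝕜 EG EN fun p => (f.ω p)⁻¹ * f'.ω p :=
    f.isC2ss.of_mul_central (by simpa only [ω_mul] using f'.isC2ss) mem_center
  refine ⟨⟨fun p => ⟨_, mem_center p⟩, isC2ss, fun g g' g'' => ?_⟩,
    FactorSystem.ext hS.symm ω_mul⟩
  have d2_mul := d2_mul_of_mem_center f.S f.ω mem_center g g' g''
  simp only [ω_mul] at d2_mul
  rw [f.d2_eq, one_mul, ← hS, f'.d2_eq] at d2_mul
  rw [d2_mul, hS]
  simp only [d2, hf.eq_on_center g (mem_center (g', g''))]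

theorem Intertwines.twist {h : G → N} (H : f.Intertwines f' h) (hf : OuterEquiv 𝕜 EG EN S f.S)
    (hf' : OuterEquiv 𝕜 EG EN S f'.S) (β : Z2ss 𝕜 EG EN S) :
    (f.twist hf β).Intertwines (f'.twist hf' β) h where
  isC1 := H.isC1
  S_mul := H.S_mul
  ω_mul g g' := by
    change f.ω (g, g') * (β.1 (g, g') : N) * h (g * g') =
      h g * f'.S g (h g') * (f'.ω (g, g') * (β.1 (g, g') : N))
    rw [mul_assoc, ← Subgroup.mem_center_iff.1 (β.1 (g, g')).2, ← mul_assoc, H.ω_mul, mul_assoc]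

theorem twist_intertwines_iff (hf : OuterEquiv 𝕜 EG EN S f.S) (β : Z2ss 𝕜 EG EN S)
    (c : G → Subgroup.center N) :
    (f.twist hf β).Intertwines f (fun g => c g) ↔ IsC1 𝕜 EG EN (fun g => (c g : N)) ∧
      ∀ g g', (β.1 (g, g') : N) = d1 S (fun g => (c g : N)) g g' := by
  have ω_mul_iff (g g' : G) : (f.twist hf β).ω (g, g') * c (g * g') = c g * f.S g (c g') *
      f.ω (g, g') ↔ (β.1 (g, g') : N) = d1 S (fun g => (c g : N)) g g' := by
    rw [hf.eq_on_center g (c g').2]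
    exact mul_mul_eq_mul_mul_iff_of_center _ _ _ (centerMap (S g) (c g')) _
  exact ⟨fun H => ⟨H.isC1, fun g g' => (ω_mul_iff g g').1 (H.ω_mul g g')⟩, fun ⟨hc, hβ⟩ =>
    ⟨hc, fun g _ => Subgroup.mem_center_iff.1 (c g).2 _, fun g g' => (ω_mul_iff g g').2 (hβ g g')⟩⟩

theorem exists_twist_intertwines_iff (hf : OuterEquiv 𝕜 EG EN S f.S) (β : Z2ss 𝕜 EG EN S) :
    (∃ h, (f.twist hf β).Intertwines f h) ↔ β.1 ∈ B2s 𝕜 EG EN S := by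
  refine ⟨fun ⟨h, H⟩ => ?_, fun ⟨c, hc⟩ => ⟨_, (f.twist_intertwines_iff hf β c).2 hc⟩⟩
  exact ⟨fun g => ⟨h g, H.mem_center rfl g⟩, (f.twist_intertwines_iff hf β _).1 H⟩

end FactorSystem

end Twist

section TwistAction

variable {𝕜 : Type w} [RCLike 𝕜]
  {EG : Type u} [AddCommGroup EG] [Module 𝕜 EG] [TopologicalSpace EG]
  [IsTopologicalAddGroup EG] [ContinuousSMul 𝕜 EG] [PolynormableSpace 𝕜 EG] [T2Space EG]
  {G : Type u} [Group G] [TopologicalSpace G] [ChartedSpace EG G] [LocConvLieGroup 𝕜 EG G]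
  {EN : Type v} [AddCommGroup EN] [Module 𝕜 EN] [TopologicalSpace EN]
  [IsTopologicalAddGroup EN] [ContinuousSMul 𝕜 EN] [PolynormableSpace 𝕜 EN] [T2Space EN]
  {N : Type v} [Group N] [TopologicalSpace N] [ChartedSpace EN N] [LocConvLieGroup 𝕜 EN N]
  {S : G → MulAut N}

namespace FactorSystem

variable {f f' : FactorSystem 𝕜 EG G EN N} (hf : OuterEquiv 𝕜 EG EN S f.S)
  (hf' : OuterEquiv 𝕜 EG EN S f'.S)

theorem extClass_twist_eq_extClass_iff (β : Z2ss 𝕜 EG EN S) :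
    (f.twist hf β).extClass = f.extClass ↔ β.1 ∈ B2s 𝕜 EG EN S :=
  extClass_eq_extClass_iff.trans (f.exists_twist_intertwines_iff hf β)

theorem extClass_twist_congr (h : f.extClass = f'.extClass) (β : Z2ss 𝕜 EG EN S) :
    (f.twist hf β).extClass = (f'.twist hf' β).extClass := by
  obtain ⟨k, hk⟩ := extClass_eq_extClass_iff.1 h
  exact extClass_eq_extClass_iff.2 ⟨k, hk.twist hf hf' β⟩

theorem extClass_twist_eq_extClass_twist_iff {β β' : Z2ss 𝕜 EG EN S} :
    (f.twist hf β).extClass = (f.twist hf β').extClass ↔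
      (β : H2ss 𝕜 EG EN S) = (β' : H2ss 𝕜 EG EN S) := by
  have hf' : OuterEquiv 𝕜 EG EN S (f.twist hf β).S := hf
  have twist_eq : f.twist hf β' = (f.twist hf β).twist hf' (β⁻¹ * β') := by
    rw [twist_twist, mul_inv_cancel_left]
  rw [twist_eq, eq_comm, extClass_twist_eq_extClass_iff, QuotientGroup.eq, Subgroup.mem_subgroupOf]

/-- The orbit map `[β] ↦ [N ×_(S',ω·β) G]` through `[N ×_(S',ω) G]` of the action of
`H²_ss(G, Z(N))_[S]` on `Ext(G, N)_[S]`. -/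
noncomputable def orbitMap (f : FactorSystem 𝕜 EG G EN N) (hf : OuterEquiv 𝕜 EG EN S f.S) :
    H2ss 𝕜 EG EN S → ExtKernel 𝕜 EG EN S :=
  Quotient.lift (fun β => ⟨(f.twist hf β).extClass, extClass_mem_extKernel hf⟩) fun _ _ h =>
    Subtype.ext ((extClass_twist_eq_extClass_twist_iff hf).2 (Quotient.sound h))

theorem coe_orbitMap_mk (β : Z2ss 𝕜 EG EN S) :
    (f.orbitMap hf β : ExtClasses 𝕜 EG G EN N) = (f.twist hf β).extClass :=
  rfl

theorem coe_orbitMap_one : (f.orbitMap hf 1 : ExtClasses 𝕜 EG G EN N) = f.extClass :=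
  congrArg extClass (f.twist_one hf)

theorem orbitMap_congr (h : f.extClass = f'.extClass) : f.orbitMap hf = f'.orbitMap hf' := by
  ext1 b
  induction b using QuotientGroup.induction_on with
  | H β => exact Subtype.ext (extClass_twist_congr hf hf' h β)

theorem orbitMap_mul_mk (b : H2ss 𝕜 EG EN S) (β : Z2ss 𝕜 EG EN S)
    (hf' : OuterEquiv 𝕜 EG EN S (f.twist hf β).S) :
    f.orbitMap hf (b * β) = (f.twist hf β).orbitMap hf' b := by
  induction b using QuotientGroup.induction_on with
  | H γ => exact Subtype.ext (by
      rw [← QuotientGroup.mk_mul, coe_orbitMap_mk, coe_orbitMap_mk, twist_twist, mul_comm γ β])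

theorem orbitMap_injective : Function.Injective (f.orbitMap hf) := by
  intro b b' h
  induction b using QuotientGroup.induction_on with | H β =>
  induction b' using QuotientGroup.induction_on with | H β' =>
  exact (extClass_twist_eq_extClass_twist_iff hf).1 (congrArg Subtype.val h)

theorem orbitMap_surjective (hfS : f.S = S) : Function.Surjective (f.orbitMap (.of_eq hfS)) := by
  rintro ⟨e, he⟩
  obtain ⟨f', hf', rfl⟩ := exists_extClass_eq (hfS ▸ f.isC1Aut) he
  obtain ⟨β, rfl⟩ := exists_twist_eq (.of_eq hfS) (hf'.trans hfS.symm)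
  exact ⟨β, rfl⟩

end FactorSystem

/-- A smooth factor system `(S, ω)` with `[N ×_(S,ω) G] = e`. -/
noncomputable def ExtKernel.factorSystem (hS : IsC1Aut 𝕜 EG EN S) (e : ExtKernel 𝕜 EG EN S) :
    FactorSystem 𝕜 EG G EN N :=
  (exists_extClass_eq hS e.2).choose

theorem ExtKernel.factorSystem_S (hS : IsC1Aut 𝕜 EG EN S) (e : ExtKernel 𝕜 EG EN S) :
    (factorSystem hS e).S = S :=
  (exists_extClass_eq hS e.2).choose_spec.1

theorem ExtKernel.extClass_factorSystem (hS : IsC1Aut 𝕜 EG EN S) (e : ExtKernel 𝕜 EG EN S) :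
    (factorSystem hS e).extClass = e :=
  (exists_extClass_eq hS e.2).choose_spec.2

/-- The action `[β] • [N ×_(S',ω) G] = [N ×_(S',ω·β) G]` of `H²_ss(G, Z(N))_[S]` on
`Ext(G, N)_[S]`. -/
noncomputable abbrev twistAction (hS : IsC1Aut 𝕜 EG EN S) :
    MulAction (H2ss 𝕜 EG EN S) (ExtKernel 𝕜 EG EN S) where
  smul b e := (ExtKernel.factorSystem hS e).orbitMap (.of_eq (ExtKernel.factorSystem_S hS e)) b
  one_smul e := Subtype.ext ((FactorSystem.coe_orbitMap_one _).trans
    (ExtKernel.extClass_factorSystem hS e))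
  mul_smul b b' e := by
    induction b' using QuotientGroup.induction_on with | H β =>
    have hf : OuterEquiv 𝕜 EG EN S (ExtKernel.factorSystem hS e).S :=
      .of_eq (ExtKernel.factorSystem_S hS e)
    let e' := (ExtKernel.factorSystem hS e).orbitMap hf β
    exact (FactorSystem.orbitMap_mul_mk hf b β hf).trans (congrFun
      (FactorSystem.orbitMap_congr _ _ (ExtKernel.extClass_factorSystem hS e').symm) b)

theorem twistAction_smul (hS : IsC1Aut 𝕜 EG EN S) {f : FactorSystem 𝕜 EG G EN N}
    (hf : OuterEquiv 𝕜 EG EN S f.S) {e : ExtKernel 𝕜 EG EN S} (he : e.1 = f.extClass)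
    (b : H2ss 𝕜 EG EN S) : (twistAction hS).smul b e = f.orbitMap hf b :=
  congrFun (FactorSystem.orbitMap_congr _ _ ((ExtKernel.extClass_factorSystem hS e).trans he)) b

theorem existsUnique_twistAction_smul_eq (hS : IsC1Aut 𝕜 EG EN S) (e e' : ExtKernel 𝕜 EG EN S) :
    ∃! b : H2ss 𝕜 EG EN S, (twistAction hS).smul b e = e' :=
  Function.Bijective.existsUnique ⟨FactorSystem.orbitMap_injective _,
    FactorSystem.orbitMap_surjective (ExtKernel.factorSystem_S hS e)⟩ e'

end TwistAction

end NonabelianExt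

theorem mainTheorem2 {𝕜 : Type w} [RCLike 𝕜]
    {EG : Type u} [AddCommGroup EG] [Module 𝕜 EG] [TopologicalSpace EG]
    [IsTopologicalAddGroup EG] [ContinuousSMul 𝕜 EG] [PolynormableSpace 𝕜 EG] [T2Space EG]
    {G : Type u} [Group G] [TopologicalSpace G] [ChartedSpace EG G] [LocConvLieGroup 𝕜 EG G]
    {EN : Type v} [AddCommGroup EN] [Module 𝕜 EN] [TopologicalSpace EN]
    [IsTopologicalAddGroup EN] [ContinuousSMul 𝕜 EN] [PolynormableSpace 𝕜 EN] [T2Space EN]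
    {N : Type v} [Group N] [TopologicalSpace N] [ChartedSpace EN N] [LocConvLieGroup 𝕜 EN N]
    (S : G → MulAut N) (hS : IsSmoothOuterAction 𝕜 EG EN S)
    (hne : (ExtKernel 𝕜 EG EN S).Nonempty) :
    -- every smooth factor system over the kernel `[S]` defines exactly one class `[N ×_(S',ω) G]`
    (∀ f : FactorSystem 𝕜 EG G EN N, OuterEquiv 𝕜 EG EN S f.S →
      ∃ e ∈ ExtKernel 𝕜 EG EN S, ∀ e', IsTwistedClass f e' ↔ e' = e) ∧
    -- every class in `Ext(G, N)_[S]` is of the form `[N ×_(S,ω) G]`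
    (∀ e ∈ ExtKernel 𝕜 EG EN S, ∃ f : FactorSystem 𝕜 EG G EN N, f.S = S ∧ IsTwistedClass f e) ∧
    -- `ω' ω⁻¹` is a cocycle, and it is a coboundary iff the extensions are equivalent
    (∀ f f' : FactorSystem 𝕜 EG G EN N, f.S = S → f'.S = S →
      ∃ β ∈ Z2ss 𝕜 EG EN S, (∀ p, (β p : N) = f'.ω p * (f.ω p)⁻¹) ∧
        ∀ e e', IsTwistedClass f e → IsTwistedClass f' e' → (e = e' ↔ β ∈ B2s 𝕜 EG EN S)) ∧
    -- `[β] • [N ×_(S',ω) G] = [N ×_(S',ω·β) G]` is a well-defined simply transitive action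
    ∃! act : MulAction (H2ss 𝕜 EG EN S) (ExtKernel 𝕜 EG EN S),
      (∀ (f : FactorSystem 𝕜 EG G EN N) (hf : OuterEquiv 𝕜 EG EN S f.S) (β : Z2ss 𝕜 EG EN S)
        (e e' : ExtKernel 𝕜 EG EN S), IsTwistedClass f e.1 → IsTwistedClass (f.twist hf β) e'.1 →
          act.smul (QuotientGroup.mk β) e = e') ∧
      ∀ e e' : ExtKernel 𝕜 EG EN S, ∃! b : H2ss 𝕜 EG EN S, act.smul b e = e' := by
  refine ⟨fun f hf => ?_, fun e he => ?_, fun f f' hf hf' => ?_, twistAction hS.1, ⟨?_, ?_⟩,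
    fun act hact => ?_⟩
  · exact ⟨_, FactorSystem.extClass_mem_extKernel hf, fun _ => isTwistedClass_iff⟩
  · obtain ⟨f, hf, rfl⟩ := exists_extClass_eq hS.1 he
    exact ⟨f, hf, isTwistedClass_iff.2 rfl⟩
  · have hfS : OuterEquiv 𝕜 EG EN S f.S := .of_eq hf
    obtain ⟨β, rfl⟩ := FactorSystem.exists_twist_eq hfS (hf'.trans hf.symm)
    refine ⟨β, β.2, fun p => eq_mul_inv_of_mul_eq (Subgroup.mem_center_iff.1 (β.1 p).2 _).symm,
      fun e e' he he' => ?_⟩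
    rw [isTwistedClass_iff.1 he, isTwistedClass_iff.1 he', eq_comm,
      FactorSystem.extClass_twist_eq_extClass_iff]
  · intro f hf β e e' he he'
    rw [twistAction_smul hS.1 hf (isTwistedClass_iff.1 he)]
    exact Subtype.ext (isTwistedClass_iff.1 he').symm
  · exact existsUnique_twistAction_smul_eq hS.1
  · refine MulAction.ext (funext₂ fun b e => ?_)
    obtain ⟨f, hf, he⟩ := exists_extClass_eq hS.1 e.2
    induction b using QuotientGroup.induction_on with | H β =>
    rw [twistAction_smul hS.1 (.of_eq hf) he.symm]
    exact hact.1 f (.of_eq hf) β e _ (isTwistedClass_iff.2 he.symm)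
      (isTwistedClass_iff.2 rfl)
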